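/- **Model.** Each of $P$ processing entities (PEs), with ids $0,\dots,P-1$, is a real RAM: every register access, constant, arithmetic operation ($+,-,\cdot,/$, floor, $\exp$, $\log$, $\log k!$), comparison, assignment, jump, write of a vertex or edge, (re)seeding of the pseudorandom number generator and draw of a variate costs a constant (one unit). There is no communication. After seeding with $s$, the generator returns a stream of independent uniform variates on $[0,1]$; streams of different seeds are independent, and all PEs share them (equal seeds give equal streams). The running time is the number of steps until the last PE halts ($\infty$ if some PE does not halt). **Directed $G(n,m)$ generator.** The task is to sample $m$ of the $n(n-1)$ off-diagonal entries of an $n\times n$ adjacency matrix without replacement. Chunk $j$ ($0\le j<P$) consists of the rows $\lfloor jn/P\rfloor,\dots,\lfloor (j+1)n/P\rfloor-1$ and belongs to PE $j$. Every PE $i$ does the following. 1. *Sample size.* Start with the interval of all chunks $[0,P)$ and $k=m$. While the current interval $[lo,hi)$ has more than one chunk, split it at $mid=\lfloor(lo+hi+1)/2\rfloor$. Seed the generator with the heap number of the current node of the recursion tree (root $1$, children of $s$ are $2s$, $2s+1$). Draw a hypergeometric variate $X$, the number of the $k$ edges in $[lo,hi)$ that fall into $[lo,mid)$, whose parameters are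 the numbers of off-diagonal entries of these intervals. Continue with $[lo,mid)$ and $k=X$ if $i<mid$, and with $[mid,hi)$ and $k-X$ otherwise. A hypergeometric variate is drawn by acceptance-rejection: with $f$ the probability mass function, $M$ a mode and $p=f(M)$, repeat drawing uniform $u,v\in[0,1]$ and setting $X=\lfloor M+\tfrac12+(2v-1)\tfrac{2}{p\,u}\rfloor$, until $X$ lies in the support and $u^2\le f(X)/p$. 2. *Vertices.* Write the local vertices (the row numbers of chunk $i$). 3. *Edges.* Seed the generator with the number of the leaf and sample $k$ of the $R$ off-diagonal entries of chunk $i$ sequentially in row-major order. While $k\ge1$ and $13k<R$, select the next entry by a random skip $S$ with $\Pr[S=s]=\binom{R-s-1}{k-1}/\binom{R}{k}$, drawn as $S=\lfloor Y\rfloor$ by acceptance-rejection from the proposal $Y=R(1-u^{1/k})$ with density $\frac kR(1-\frac yR)^{k-1}$ and rejection constant $\frac{R}{R-k+1}$, then replace $(R,k)$ by $(R-S-1,k-1)$. After that, while $k\ge1$, scan: select the next entry with probability $k/R$, and decrease $R$ by $1$, and $k$ by $1$ if it was selected. Selected entries are converted into directed edges by offset computations and written. **Theorem.** The directed $G(n,m)$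 generator runs in time $\mathcal O((n+m)/P+\log P)$ with high probability. That is: for all constants $c>0$ and $A$ there is a constant $C>0$ such that for all integers $n\ge 0$, $P\ge1$ and $0\le m\le n(n-1)$ with $P\le A\,n$, the running time is at most $$C\left(\frac{n+m}{P}+\log P\right)$$ with probability at least $1-P^{-c}$. (For $A=1$: all $P\le n$.) -/

import Mathlib

open MeasureTheory
open scoped ENNReal

namespace DirectedER

noncomputable section

/-! ## A real RAM with a pseudorandom number generator, and its step count -/

/-- The registers of a processing entity (PE). The first four hold its input: the number of
vertices, the number of edges, the number of PEs, and its own id. -/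
inductive Var
  | n | m | P | i
  | lo | hi | mid | node
  | k | N | K | mode | pMode | done
  | u | v | x | y
  | t | R | row | col
  deriving DecidableEq

/-- Arithmetic expressions. The unary operation `logFact` is the logarithm of the factorial. -/
inductive Expr
  | var (r : Var)
  | const (c : ℕ)
  | add (a b : Expr)
  | sub (a b : Expr)
  | mul (a b : Expr)
  | div (a b : Expr)
  | floor (a : Expr)
  | exp (a : Expr)
  | log (a : Expr)
  | logFact (a : Expr)

instance : Add Expr := ⟨Expr.add⟩
instance : Sub Expr := ⟨Expr.sub⟩
instance : Mul Expr := ⟨Expr.mul⟩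
instance : Div Expr := ⟨Expr.div⟩
instance (c : ℕ) : OfNat Expr c := ⟨Expr.const c⟩

/-- Value of an expression, in exact real arithmetic. -/
def Expr.eval (σ : Var → ℝ) : Expr → ℝ
  | .var r => σ r
  | .const c => (c : ℝ)
  | .add a b => a.eval σ + b.eval σ
  | .sub a b => a.eval σ - b.eval σ
  | .mul a b => a.eval σ * b.eval σ
  | .div a b => a.eval σ / b.eval σ
  | .floor a => (⌊a.eval σ⌋ : ℝ)
  | .exp a => Real.exp (a.eval σ)
  | .log a => Real.log (a.eval σ)
  | .logFact a => Real.log (Nat.factorial ⌊a.eval σ⌋₊ : ℝ)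

/-- Cost of evaluating an expression: every register access, constant and operation costs one
time unit. -/
def Expr.cost : Expr → ℕ
  | .var _ => 1
  | .const _ => 1
  | .add a b => a.cost + b.cost + 1
  | .sub a b => a.cost + b.cost + 1
  | .mul a b => a.cost + b.cost + 1
  | .div a b => a.cost + b.cost + 1
  | .floor a => a.cost + 1
  | .exp a => a.cost + 1
  | .log a => a.cost + 1
  | .logFact a => a.cost + 1

/-- Tests. -/
inductive Test
  | lt (a b : Expr)
  | le (a b : Expr)
  | and (p q : Test)

def Test.Holds (σ : Var → ℝ) : Test → Prop
  | .lt a b => a.eval σ < b.eval σ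
  | .le a b => a.eval σ ≤ b.eval σ
  | .and p q => p.Holds σ ∧ q.Holds σ

def Test.cost : Test → ℕ
  | .lt a b => a.cost + b.cost + 1
  | .le a b => a.cost + b.cost + 1
  | .and p q => p.cost + q.cost + 1

/-- Programs of a PE. There is no command for communication. -/
inductive Cmd
  | skip
  | assign (r : Var) (e : Expr)
  /-- Initialize the generator with the hash value of `e`. -/
  | seed (e : Expr)
  /-- Put the next variate of the generator, uniform on `[0,1]`, into the register `r`. -/
  | draw (r : Var)
  | emitVertex (e : Expr)
  | emitEdge (e e' : Expr)
  | seq (c d : Cmd)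
  | ite (b : Test) (c d : Cmd)
  | while (b : Test) (c : Cmd)

/-- State of a PE: registers, state of the generator (current seed and number of variates already
drawn with it), and the part of the graph written so far. -/
structure State where
  reg : Var → ℝ
  seed : ℕ
  drawn : ℕ
  vertices : List ℕ
  edges : List (ℕ × ℕ)

/-- A random source: `ω (s, j)` is the `j`-th variate that the generator returns after it has been
initialized with the hash value of the seed `s`. All PEs use the same source, so that equal seeds
give equal variates on different PEs. -/
abbrev Source := ℕ × ℕ → unitInterval

/-- The variates are independent and uniform on `[0,1]`, both along one seed and for different
seeds. -/
def sourceMeasure : Measure Source := Measure.infinitePi fun _ : ℕ × ℕ => volume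

/-- `Exec ω c s T s'`: with the random source `ω`, the program `c`, started in the state `s`, halts
in the state `s'` after exactly `T` time units. -/
inductive Exec (ω : Source) : Cmd → State → ℕ → State → Prop
  | skip (s : State) : Exec ω .skip s 1 s
  | assign (r : Var) (e : Expr) (s : State) :
      Exec ω (.assign r e) s (e.cost + 1)
        { s with reg := Function.update s.reg r (e.eval s.reg) }
  | seed (e : Expr) (s : State) :
      Exec ω (.seed e) s (e.cost + 1) { s with seed := ⌊e.eval s.reg⌋₊, drawn := 0 }
  | draw (r : Var) (s : State) :
      Exec ω (.draw r) s 1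
        { s with
          reg := Function.update s.reg r (ω (s.seed, s.drawn) : ℝ)
          drawn := s.drawn + 1 }
  | emitVertex (e : Expr) (s : State) :
      Exec ω (.emitVertex e) s (e.cost + 1) { s with vertices := ⌊e.eval s.reg⌋₊ :: s.vertices }
  | emitEdge (e e' : Expr) (s : State) :
      Exec ω (.emitEdge e e') s (e.cost + e'.cost + 1)
        { s with edges := (⌊e.eval s.reg⌋₊, ⌊e'.eval s.reg⌋₊) :: s.edges }
  | seq {c d : Cmd} {s s' s'' : State} {T T' : ℕ} :
      Exec ω c s T s' → Exec ω d s' T' s'' → Exec ω (.seq c d) s (T + T') s''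
  | iteTrue {b : Test} {c d : Cmd} {s s' : State} {T : ℕ} :
      b.Holds s.reg → Exec ω c s T s' → Exec ω (.ite b c d) s (b.cost + T + 1) s'
  | iteFalse {b : Test} {c d : Cmd} {s s' : State} {T : ℕ} :
      ¬ b.Holds s.reg → Exec ω d s T s' → Exec ω (.ite b c d) s (b.cost + T + 1) s'
  | whileTrue {b : Test} {c : Cmd} {s s' s'' : State} {T T' : ℕ} :
      b.Holds s.reg → Exec ω c s T s' → Exec ω (.while b c) s' T' s'' →
        Exec ω (.while b c) s (b.cost + T + T' + 1) s''
  | whileFalse {b : Test} {c : Cmd} {s : State} :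
      ¬ b.Holds s.reg → Exec ω (.while b c) s (b.cost + 1) s

/-! ## The generator -/

infixr:30 " ;; " => Cmd.seq
infix:40 " ::= " => Cmd.assign
infix:50 " ≺ " => Test.lt
infix:50 " ≼ " => Test.le
infixr:45 " & " => Test.and

abbrev n : Expr := .var .n
abbrev m : Expr := .var .m
abbrev P : Expr := .var .P
abbrev i : Expr := .var .i
abbrev lo : Expr := .var .lo
abbrev hi : Expr := .var .hi
abbrev mid : Expr := .var .mid
abbrev node : Expr := .var .node
abbrev k : Expr := .var .k
abbrev N : Expr := .var .N
abbrev K : Expr := .var .K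
abbrev mode : Expr := .var .mode
abbrev pMode : Expr := .var .pMode
abbrev done : Expr := .var .done
abbrev u : Expr := .var .u
abbrev v : Expr := .var .v
abbrev x : Expr := .var .x
abbrev y : Expr := .var .y
abbrev t : Expr := .var .t
abbrev R : Expr := .var .R
abbrev row : Expr := .var .row
abbrev col : Expr := .var .col

/-- First row of the chunk `j`: the chunk consists of the rows
`⌊j * n / P⌋, …, ⌊(j + 1) * n / P⌋ - 1` of the adjacency matrix. -/
def firstRow (j : Expr) : Expr := .floor (j * n / P)

/-- Number of off-diagonal entries (possible edges) in the chunks `a, …, b - 1`. -/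
def cells (a b : Expr) : Expr := (firstRow b - firstRow a) * (n - 1)

/-- Logarithm of the binomial coefficient. -/
def logChoose (a b : Expr) : Expr := .logFact a - .logFact b - .logFact (a - b)

/-- Logarithm of the probability that `k` draws without replacement from `N` elements, `K` of which
are marked, give exactly `z` marked elements. -/
def logHyp (z : Expr) : Expr := logChoose K z + logChoose (N - K) (k - z) - logChoose N k

/-- Acceptance-rejection (ratio of uniforms) for the hypergeometric distribution: puts a variate
with the parameters `N`, `K`, `k` into the register `x`. A point that is uniform in the rectangle
`(0, 1] × [-2 / p, 2 / p]`, where `p` is the probability of the mode, is drawn until it lies in the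
region that belongs to the probability mass function divided by `p`. -/
def hypergeometric : Cmd :=
  .mode ::= .floor ((k + 1) * (K + 1) / (N + 2)) ;;
  .pMode ::= .exp (logHyp mode) ;;
  .done ::= 0 ;;
  .while (done ≺ 1) (
    .draw .u ;;
    .draw .v ;;
    .x ::= .floor (mode + 1 / 2 + (2 * v - 1) * (2 / pMode) / u) ;;
    .ite (0 ≼ x & k + K - N ≼ x & x ≼ k & x ≼ K & u * u * pMode ≼ .exp (logHyp x))
      (.done ::= 1)
      .skip)

/-- Divide and conquer on the chunks `lo, …, hi - 1`, which contain `k` of the edges: follow the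
half that contains the chunk of this PE. The nodes of the recursion tree are numbered as in a binary
heap, and the number of the node is the seed. -/
def chooseSampleSize : Cmd :=
  .lo ::= 0 ;;
  .hi ::= P ;;
  .node ::= 1 ;;
  .k ::= m ;;
  .while (lo + 1 ≺ hi) (
    .mid ::= .floor ((lo + hi + 1) / 2) ;;
    .N ::= cells lo hi ;;
    .K ::= cells lo mid ;;
    .seed node ;;
    hypergeometric ;;
    .ite (i ≺ mid)
      (.hi ::= mid ;; .k ::= x ;; .node ::= 2 * node)
      (.lo ::= mid ;; .k ::= k - x ;; .node ::= 2 * node + 1))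

/-- Write the local vertices. -/
def writeVertices : Cmd :=
  .row ::= firstRow lo ;;
  .while (row ≺ firstRow hi) (
    .emitVertex row ;;
    .row ::= row + 1)

/-- Offset computation: write the possible edge with the index `e` in the chunk `lo`. The indices
run through the rows of the chunk, and skip the diagonal. -/
def writeEdge (e : Expr) : Cmd :=
  .row ::= firstRow lo + .floor (e / (n - 1)) ;;
  .col ::= e - (n - 1) * .floor (e / (n - 1)) ;;
  .ite (row ≼ col) (.col ::= col + 1) .skip ;;
  .emitEdge row col

/-- One step of sequential sampling by skips, when `k` elements are still to be sampled from the
`R` indices `t, …, t + R - 1`: draw the number `x` of indices to be skipped by acceptance-rejection,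
from the proposal `y` with density `k / R * (1 - y / R) ^ (k - 1)` on `[0, R]` and with the rejection
constant `R / (R - k + 1)`, then select the next index. -/
def skipStep : Cmd :=
  .done ::= 0 ;;
  .while (done ≺ 1) (
    .draw .u ;;
    .draw .v ;;
    .y ::= R * (1 - .exp (.log u / k)) ;;
    .x ::= .floor y ;;
    .ite (x ≼ R - k &
        v * (R / (R - k + 1)) * (k / R * .exp ((k - 1) * .log (1 - y / R))) ≼
          .exp (logChoose (R - x - 1) (k - 1) - logChoose R k))
      (.done ::= 1)
      .skip) ;;
  writeEdge (t + x) ;;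
  .t ::= t + x + 1 ;;
  .R ::= R - x - 1 ;;
  .k ::= k - 1

/-- One step of sequential sampling by a scan: select the index `t` with probability `k / R`. -/
def scanStep : Cmd :=
  .draw .u ;;
  .ite (u * R ≼ k) (writeEdge t ;; .k ::= k - 1) .skip ;;
  .t ::= t + 1 ;;
  .R ::= R - 1

/-- Sequential sampling without replacement of `k` of the possible edges in the chunk `lo`: by skips
while the sample is sparse, then by a scan. -/
def sampleChunk : Cmd :=
  .seed node ;;
  .t ::= 0 ;;
  .R ::= cells lo hi ;;
  .while (1 ≼ k & 13 * k ≺ R) skipStep ;;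
  .while (1 ≼ k) scanStep

/-- The program that every PE runs. -/
def generator : Cmd := chooseSampleSize ;; writeVertices ;; sampleChunk

/-- Initial state of the PE with the id `pe`. -/
def init (nV nE nPE pe : ℕ) : State where
  reg := fun
    | .n => nV
    | .m => nE
    | .P => nPE
    | .i => pe
    | _ => 0
  seed := 0
  drawn := 0
  vertices := []
  edges := []

/-- Running time of one PE; it is `⊤` if the PE does not halt. -/
def peTime (ω : Source) (nV nE nPE pe : ℕ) : ℕ∞ :=
  ⨅ (T : ℕ) (_ : ∃ s', Exec ω generator (init nV nE nPE pe) T s'), (T : ℕ∞)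

/-- Running time of the parallel generator: the time until the last of the PEs halts. -/
def runningTime (ω : Source) (nV nE nPE : ℕ) : ℕ∞ := ⨆ pe : Fin nPE, peTime ω nV nE nPE pe

end

end DirectedER

namespace DirectedER

set_option linter.unusedSimpArgs false

section

/-! ## Binomial coefficients and the hypergeometric distribution -/

/-! A PE pays for the depth of the recursion tree, which is logarithmic in P, for its n/P + 1 rows
at most, for the rejected candidates of both samplers, and for its final sample size. The last two
are random. They are controlled outside an exceptional event, and a union bound over PEs and seeds
finishes the proof.

Hypergeometric sampler. One round accepts the value x with probability exactly f(x)/8: for given u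
the accepted v form an interval of length pu/4, u ranges up to the square root of f(x)/p, and the
integral is f(x)/8 (`volume_hypAccept`). The interval must not be cut off at 0 or 1. This holds
because f is log-concave, which forces √(p f(x)) (|x - M| + 1) ≤ 1 (`sqrt_hypProb_hypMode_mul_le`).
Hence a round rejects with probability 7/8, and the accepted value has the law f.

Recursion. Let κ be the final sample size and τ the total number of rejected hypergeometric
candidates of a PE. Both are handled by one exponential moment, that of 2^κ (15/14)^τ. A level
contributes the factor ∑ (15/14 · 7/8)^j / 8 = 2. The sample sizes contribute hypergeometric
generating functions, which are dominated by binomial ones; with q the cells of the PE, the weight 1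
+ q/K below a node with K cells averages to at most 1 + q/N at its parent with N cells, so the bound
telescopes to (1 + q/N)^m at the root (`lintegral_potential_le`). As P ≤ A n, this is at most exp((1
+ A) m/P), and Markov's inequality bounds κ and τ together. Nodes have different seeds, so the
randomness below a node is independent of the node.

Skips. Whenever 13k < R, every pair with u ≥ 2/3 and v ≤ 2/5 is accepted, whatever k and R are
(`skipTest_holds`). So the number of rounds is bounded through the number of such pairs in the
stream of a seed, which does not depend on the course of the program. A Chernoff bound shows that
30B pairs contain at least B of them except with probability e^(-B). Requiring this for all seeds of
the tree avoids conditioning on the sample size. When skipping stops, either k = 0 or R ≤ 13k, so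
the scan costs O(k). -/

theorem choose_mul_choose_le (K a s t : ℕ) :
    K.choose a * K.choose (a + s + t) ≤ K.choose (a + s) * K.choose (a + t) := by
  -- The quotient of consecutive binomial coefficients, (K - a)/(a + 1), decreases in a. This is the
  -- case s = 1; larger s follow by chaining single steps and cancelling a common factor.
  have single (a t : ℕ) :
      K.choose a * K.choose (a + 1 + t) ≤ K.choose (a + 1) * K.choose (a + t) := by
    have h1 := Nat.choose_succ_right_eq K a
    have h2 := Nat.choose_succ_right_eq K (a + t)
    rw [show a + t + 1 = a + 1 + t by ring] at h2
    refine Nat.le_of_mul_le_mul_left (c := (a + 1) * (a + 1 + t)) ?_ (by positivity)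
    calc (a + 1) * (a + 1 + t) * (K.choose a * K.choose (a + 1 + t))
        = K.choose a * (a + 1) * (K.choose (a + 1 + t) * (a + 1 + t)) := by ring
      _ = K.choose a * K.choose (a + t) * ((a + 1) * (K - (a + t))) := by rw [h2]; ring
      _ ≤ K.choose a * K.choose (a + t) * ((a + 1 + t) * (K - a)) :=
          Nat.mul_le_mul_left _ (Nat.mul_le_mul (by omega) (by omega))
      _ = K.choose (a + 1) * (a + 1) * K.choose (a + t) * (a + 1 + t) := by rw [h1]; ring
      _ = (a + 1) * (a + 1 + t) * (K.choose (a + 1) * K.choose (a + t)) := by ring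
  induction s generalizing a with
  | zero => simp
  | succ s ih =>
    -- Past K the left side vanishes; otherwise the factor to be cancelled is positive.
    rcases lt_or_ge K (a + (s + 1) + t) with h | h
    · simp [Nat.choose_eq_zero_of_lt h]
    have hpos : 0 < K.choose (a + 1) * K.choose (a + 1 + t) :=
      Nat.mul_pos (Nat.choose_pos (by omega)) (Nat.choose_pos (by omega))
    refine Nat.le_of_mul_le_mul_left ?_ hpos
    have := Nat.mul_le_mul (single a t) (ih (a + 1))
    rw [show a + (s + 1) + t = a + 1 + s + t by ring, show a + (s + 1) = a + 1 + s by ring]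
    linarith

/-- Each factor of the quotient of falling factorials satisfies (K - i)/(N - i) ≤ K/N. This is where
sampling without replacement is compared with sampling with replacement. -/
theorem choose_mul_pow_le {K N : ℕ} (h : K ≤ N) (r : ℕ) :
    K.choose r * N ^ r ≤ N.choose r * K ^ r := by
  induction r with
  | zero => simp
  | succ r ih =>
    have h1 := Nat.choose_succ_right_eq K r
    have h2 := Nat.choose_succ_right_eq N r
    have h3 : (K - r) * N ≤ (N - r) * K := by
      rw [Nat.sub_mul, Nat.sub_mul, Nat.mul_comm N K]
      exact Nat.sub_le_sub_left (Nat.mul_le_mul_left r h) _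
    refine Nat.le_of_mul_le_mul_left (c := r + 1) ?_ (by positivity)
    calc (r + 1) * (K.choose (r + 1) * N ^ (r + 1))
        = K.choose (r + 1) * (r + 1) * N ^ r * N := by ring
      _ = (K.choose r * N ^ r) * ((K - r) * N) := by rw [h1]; ring
      _ ≤ (N.choose r * K ^ r) * ((N - r) * K) := Nat.mul_le_mul ih h3
      _ = N.choose (r + 1) * (r + 1) * K ^ r * K := by rw [h2]; ring
      _ = (r + 1) * (N.choose (r + 1) * K ^ (r + 1)) := by ring

theorem sum_choose_mul_choose (K Q k : ℕ) :
    ∑ x ∈ Finset.range (k + 1), K.choose x * Q.choose (k - x) = (K + Q).choose k := by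
  rw [Nat.add_choose_eq, Finset.Nat.sum_antidiagonal_eq_sum_range_succ
    (fun a b => K.choose a * Q.choose b)]

/-- Binomial moments of the hypergeometric distribution: choosing x and then r of these is choosing
r first, and Vandermonde sums the rest. -/
theorem sum_choose_mul_choose_mul_choose (K Q k r : ℕ) :
    ∑ x ∈ Finset.range (k + 1), K.choose x * Q.choose (k - x) * x.choose r
      ≤ K.choose r * (K + Q - r).choose (k - r) := by
  rcases lt_or_ge k r with hk | hk
  · refine (Finset.sum_eq_zero fun x hx => ?_).trans_le (Nat.zero_le _)
    rw [Nat.choose_eq_zero_of_lt (show x < r by simp at hx; omega), mul_zero]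
  rcases lt_or_ge K r with hK | hK
  · refine (Finset.sum_eq_zero fun x hx => ?_).trans_le (Nat.zero_le _)
    rcases lt_or_ge x r with h | h
    · rw [Nat.choose_eq_zero_of_lt h, mul_zero]
    · rw [Nat.choose_eq_zero_of_lt (show K < x by omega), zero_mul, zero_mul]
  obtain ⟨e, rfl⟩ := Nat.exists_eq_add_of_le hk
  rw [show r + e + 1 = r + (e + 1) by ring, Finset.sum_range_add]
  have h0 : ∑ x ∈ Finset.range r, K.choose x * Q.choose (r + e - x) * x.choose r = 0 :=
    Finset.sum_eq_zero fun x hx => by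
      rw [Nat.choose_eq_zero_of_lt (show x < r by simpa using hx), mul_zero]
  have h1 : ∑ x ∈ Finset.range (e + 1),
      K.choose (r + x) * Q.choose (r + e - (r + x)) * (r + x).choose r =
      ∑ x ∈ Finset.range (e + 1), K.choose r * ((K - r).choose x * Q.choose (e - x)) := by
    refine Finset.sum_congr rfl fun x hx => ?_
    have := Nat.choose_mul (n := K) (show r ≤ r + x by omega)
    rw [show r + x - r = x by omega] at this
    rw [show r + e - (r + x) = e - x by omega]
    linear_combination Q.choose (e - x) * this
  rw [h0, h1, ← Finset.mul_sum, sum_choose_mul_choose, zero_add,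
    show K - r + Q = K + Q - r by omega, show r + e - r = e by omega]

/-- The moment generating function of the hypergeometric distribution is at most that of the
binomial distribution. -/
theorem sum_choose_mul_choose_mul_pow_le (K Q k : ℕ) {b : ℝ} (hb : 0 ≤ b) :
    ∑ x ∈ Finset.range (k + 1), (K.choose x * Q.choose (k - x) : ℝ) * (1 + b) ^ x
      ≤ (K + Q).choose k * (1 + b * (K / ((K + Q : ℕ) : ℝ))) ^ k := by
  -- Expanding (1 + b)^x in powers of b turns the generating function into a combination of binomial
  -- moments with nonnegative coefficients, so it can be compared with the binomial one term by
  -- term.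
  have hx : ∀ x ∈ Finset.range (k + 1), (K.choose x * Q.choose (k - x) : ℝ) * (1 + b) ^ x =
      ∑ r ∈ Finset.range (k + 1),
        b ^ r * ((K.choose x * Q.choose (k - x) * x.choose r : ℕ) : ℝ) := by
    intro x hx
    have h1 : (1 + b) ^ x = ∑ r ∈ Finset.range (k + 1), b ^ r * (x.choose r : ℝ) := by
      rw [add_comm, add_pow]
      simp only [one_pow, mul_one]
      refine Finset.sum_subset (fun r hr => ?_) fun r _ hr => ?_
      · simp at hr hx ⊢; omega
      · rw [Nat.choose_eq_zero_of_lt (by simpa using hr)]; simp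
    rw [h1, Finset.mul_sum]
    exact Finset.sum_congr rfl fun r _ => by push_cast; ring
  rw [Finset.sum_congr rfl hx, Finset.sum_comm, add_comm (1 : ℝ), add_pow, Finset.mul_sum]
  refine Finset.sum_le_sum fun r hr => ?_
  have hrk : r ≤ k := by simp at hr; omega
  rw [← Finset.mul_sum, ← Nat.cast_sum, one_pow, mul_one, mul_pow]
  have h1 : ((∑ x ∈ Finset.range (k + 1), K.choose x * Q.choose (k - x) * x.choose r : ℕ) : ℝ) ≤
      (K.choose r : ℝ) * (K + Q - r).choose (k - r) := by
    exact_mod_cast sum_choose_mul_choose_mul_choose K Q k r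
  have h2 : ((K + Q).choose k : ℝ) * k.choose r = (K + Q).choose r * (K + Q - r).choose (k - r) := by
    exact_mod_cast Nat.choose_mul (n := K + Q) hrk
  have h3 : (K.choose r : ℝ) ≤ (K + Q).choose r * (K / ((K + Q : ℕ) : ℝ)) ^ r := by
    rcases Nat.eq_zero_or_pos (K + Q) with h | h
    · obtain rfl : K = 0 := by omega
      obtain rfl : Q = 0 := by omega
      rcases r with _ | r <;> simp
    · have : (0 : ℝ) < ((K + Q : ℕ) : ℝ) := by exact_mod_cast h
      rw [div_pow, ← mul_div_assoc, le_div_iff₀ (by positivity)]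
      exact_mod_cast choose_mul_pow_le (Nat.le_add_right K Q) r
  calc b ^ r * _ ≤ b ^ r * ((K.choose r : ℝ) * (K + Q - r).choose (k - r)) := by gcongr
    _ ≤ b ^ r * (((K + Q).choose r * (K / ((K + Q : ℕ) : ℝ)) ^ r)
          * (K + Q - r).choose (k - r)) := by gcongr
    _ = _ := by linear_combination -(b ^ r * (K / ((K + Q : ℕ) : ℝ)) ^ r) * h2

/-! ### The hypergeometric mass function -/

noncomputable section

/-- Probability that `k` draws without replacement from `N` elements, `K` of which are marked, give
exactly `x ≤ k` marked elements. -/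
def hypProb (N K k x : ℕ) : ℝ := K.choose x * (N - K).choose (k - x) / N.choose k

/-- A mode of the hypergeometric distribution. -/
def hypMode (N K k : ℕ) : ℕ := (k + 1) * (K + 1) / (N + 2)

end

variable {N K k : ℕ}

theorem hypProb_nonneg (N K k x : ℕ) : 0 ≤ hypProb N K k x := by
  unfold hypProb; positivity

theorem sum_hypProb (hK : K ≤ N) (hk : k ≤ N) :
    ∑ x ∈ Finset.range (k + 1), hypProb N K k x = 1 := by
  have h := sum_choose_mul_choose K (N - K) k
  rw [show K + (N - K) = N by omega] at h
  have h0 : (0 : ℝ) < N.choose k := by exact_mod_cast Nat.choose_pos hk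
  unfold hypProb
  rw [← Finset.sum_div, div_eq_one_iff_eq h0.ne']
  exact_mod_cast h

theorem sum_hypProb_mul_pow_le (hK : K ≤ N) (hk : k ≤ N) {b : ℝ} (hb : 0 ≤ b) :
    ∑ x ∈ Finset.range (k + 1), hypProb N K k x * (1 + b) ^ x ≤ (1 + b * (K / N)) ^ k := by
  have h := sum_choose_mul_choose_mul_pow_le K (N - K) k hb
  rw [show K + (N - K) = N by omega] at h
  have h0 : (0 : ℝ) < N.choose k := by exact_mod_cast Nat.choose_pos hk
  unfold hypProb
  simp only [div_mul_eq_mul_div]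
  rw [← Finset.sum_div, div_le_iff₀ h0]
  linarith

/-- The unmarked elements among the draws are hypergeometric too, with N - K in place of K. This
serves the right half of a split. -/
theorem sum_hypProb_mul_pow_sub_le (hK : K ≤ N) (hk : k ≤ N) {b : ℝ} (hb : 0 ≤ b) :
    ∑ x ∈ Finset.range (k + 1), hypProb N K k x * (1 + b) ^ (k - x)
      ≤ (1 + b * ((N - K : ℕ) / N)) ^ k := by
  refine le_trans (le_of_eq ?_) (sum_hypProb_mul_pow_le (Nat.sub_le N K) hk hb)
  rw [← Finset.sum_range_reflect]
  refine Finset.sum_congr rfl fun x hx => ?_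
  have : x ≤ k := by simp at hx; omega
  unfold hypProb
  rw [show k + 1 - 1 - x = k - x by omega, show k - (k - x) = x by omega,
    show N - (N - K) = K by omega]
  ring

/-! ### Mode, unimodality and log-concavity -/

theorem hypMode_le_left (hK : K ≤ N) : hypMode N K k ≤ k := by
  unfold hypMode
  rw [← Nat.lt_succ_iff, Nat.div_lt_iff_lt_mul (by omega)]
  exact Nat.mul_lt_mul_of_pos_left (by omega) (by omega)

theorem hypMode_le_right (hk : k ≤ N) : hypMode N K k ≤ K := by
  unfold hypMode
  rw [← Nat.lt_succ_iff, Nat.div_lt_iff_lt_mul (by omega), mul_comm]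
  exact Nat.mul_lt_mul_of_pos_left (by omega) (by omega)

theorem le_hypMode (hK : K ≤ N) (hk : k ≤ N) : k + K ≤ N + hypMode N K k := by
  rw [← Nat.sub_le_iff_le_add', hypMode, Nat.le_div_iff_mul_le (by omega)]
  rcases le_total (k + K) N with h | h
  · simp [Nat.sub_eq_zero_of_le h]
  · obtain ⟨a, rfl⟩ := Nat.exists_eq_add_of_le hK
    zify [h]
    have hk' : (k : ℤ) ≤ K + a := by exact_mod_cast hk
    nlinarith [mul_nonneg (sub_nonneg.2 hk') (Int.natCast_nonneg a)]

theorem hypProb_pos {x : ℕ} (hK : K ≤ N) (hk : k ≤ N) (h1 : k + K ≤ N + x) (h2 : x ≤ k)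
    (h3 : x ≤ K) : 0 < hypProb N K k x := by
  have a1 := Nat.choose_pos h3
  have a2 := Nat.choose_pos (show k - x ≤ N - K by omega)
  have a3 := Nat.choose_pos hk
  unfold hypProb; positivity

theorem hypProb_hypMode_pos (hK : K ≤ N) (hk : k ≤ N) : 0 < hypProb N K k (hypMode N K k) :=
  hypProb_pos hK hk (le_hypMode hK hk) (hypMode_le_left hK) (hypMode_le_right hk)

theorem hypProb_eq_zero {x : ℕ} (hK : K ≤ N) (h2 : x ≤ k) (h : ¬ (k + K ≤ N + x ∧ x ≤ K)) :
    hypProb N K k x = 0 := by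
  unfold hypProb
  rcases lt_or_ge K x with h3 | h3
  · simp [Nat.choose_eq_zero_of_lt h3]
  · rw [Nat.choose_eq_zero_of_lt (show N - K < k - x by omega)]; simp

/-- The quotient of consecutive values of the probability mass function. -/
theorem hypProb_succ_mul {x : ℕ} (hx : x < k) :
    hypProb N K k (x + 1) * ((x + 1) * ((N - K - (k - x - 1) : ℕ) : ℝ)) =
      hypProb N K k x * (((K - x : ℕ) : ℝ) * (k - x : ℕ)) := by
  have h1 : (K.choose (x + 1) : ℝ) * (x + 1) = K.choose x * (K - x : ℕ) := by
    exact_mod_cast Nat.choose_succ_right_eq K x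
  have h2 : ((N - K).choose (k - x) : ℝ) * (k - x : ℕ) =
      (N - K).choose (k - x - 1) * (N - K - (k - x - 1) : ℕ) := by
    have := Nat.choose_succ_right_eq (N - K) (k - x - 1)
    rw [show k - x - 1 + 1 = k - x by omega] at this
    exact_mod_cast this
  unfold hypProb
  rw [show k - (x + 1) = k - x - 1 by omega, div_mul_eq_mul_div, div_mul_eq_mul_div]
  congr 1
  calc _ = ((K.choose (x + 1) : ℝ) * (x + 1)) *
        ((N - K).choose (k - x - 1) * (N - K - (k - x - 1) : ℕ)) := by ring
    _ = _ := by rw [h1, ← h2]; ring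

/-- Inside the support, f(x) ≤ f(x + 1) amounts to (x + 1)(N - K - k + x + 1) ≤ (K - x)(k - x),
which simplifies to (x + 1)(N + 2) ≤ (k + 1)(K + 1). This explains the formula for the mode. -/
theorem hypProb_le_succ {x : ℕ} (hK : K ≤ N) (hk : k ≤ N) (hx : x + 1 ≤ hypMode N K k) :
    hypProb N K k x ≤ hypProb N K k (x + 1) := by
  have hxk : x < k := lt_of_lt_of_le hx (hypMode_le_left hK)
  have hxK : x < K := lt_of_lt_of_le hx (hypMode_le_right hk)
  rcases lt_or_ge (N - K) (k - x) with h | h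
  · rw [hypProb_eq_zero hK hxk.le (by omega)]; exact hypProb_nonneg _ _ _ _
  have e := hypProb_succ_mul (N := N) (K := K) hxk
  rw [hypMode, Nat.le_div_iff_mul_le (by omega)] at hx
  -- New variables for the differences, so that no truncated subtraction is left in the inequality.
  obtain ⟨Q, rfl⟩ := Nat.exists_eq_add_of_le hK
  obtain ⟨y, rfl⟩ := Nat.exists_eq_add_of_lt hxk
  obtain ⟨z, rfl⟩ := Nat.exists_eq_add_of_lt hxK
  obtain ⟨w, rfl⟩ : ∃ w, Q = y + 1 + w := ⟨Q - (y + 1), by omega⟩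
  have e1 : x + z + 1 + (y + 1 + w) - (x + z + 1) - (x + y + 1 - x - 1) = w + 1 := by omega
  have e2 : x + z + 1 - x = z + 1 := by omega
  have e3 : x + y + 1 - x = y + 1 := by omega
  rw [e1, e2, e3] at e
  have hle : ((x : ℝ) + 1) * ((w + 1 : ℕ) : ℝ) ≤ ((z + 1 : ℕ) : ℝ) * ((y + 1 : ℕ) : ℝ) := by
    have : (x + 1) * (w + 1) ≤ (z + 1) * (y + 1) := by nlinarith
    exact_mod_cast this
  have hpos : (0 : ℝ) < ((x : ℝ) + 1) * ((w + 1 : ℕ) : ℝ) := by positivity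
  refine le_of_mul_le_mul_right ?_ hpos
  rw [e]
  exact mul_le_mul_of_nonneg_left hle (hypProb_nonneg _ _ _ _)

theorem hypProb_succ_le {x : ℕ} (hK : K ≤ N) (hx : hypMode N K k ≤ x) (hxk : x < k) :
    hypProb N K k (x + 1) ≤ hypProb N K k x := by
  rcases le_or_gt K x with hxK | hxK
  · rw [hypProb_eq_zero hK hxk (by omega)]; exact hypProb_nonneg _ _ _ _
  rcases lt_or_ge (N - K) (k - x - 1) with h | h
  · rw [hypProb_eq_zero hK hxk (by omega)]; exact hypProb_nonneg _ _ _ _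
  have e := hypProb_succ_mul (N := N) (K := K) hxk
  rw [hypMode, ← Nat.lt_succ_iff, Nat.div_lt_iff_lt_mul (by omega), Nat.succ_eq_add_one] at hx
  obtain ⟨Q, rfl⟩ := Nat.exists_eq_add_of_le hK
  obtain ⟨y, rfl⟩ := Nat.exists_eq_add_of_lt hxk
  obtain ⟨z, rfl⟩ := Nat.exists_eq_add_of_lt hxK
  obtain ⟨w, rfl⟩ : ∃ w, Q = y + w := ⟨Q - y, by omega⟩
  have e1 : x + z + 1 + (y + w) - (x + z + 1) - (x + y + 1 - x - 1) = w := by omega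
  have e2 : x + z + 1 - x = z + 1 := by omega
  have e3 : x + y + 1 - x = y + 1 := by omega
  rw [e1, e2, e3] at e
  have hle : ((z + 1 : ℕ) : ℝ) * ((y + 1 : ℕ) : ℝ) ≤ ((x : ℝ) + 1) * (w : ℝ) := by
    have : (z + 1) * (y + 1) ≤ (x + 1) * w := by nlinarith
    exact_mod_cast this
  have hpos : (0 : ℝ) < ((x : ℝ) + 1) * (w : ℝ) := lt_of_lt_of_le (by positivity) hle
  refine le_of_mul_le_mul_right ?_ hpos
  rw [e]
  exact mul_le_mul_of_nonneg_left hle (hypProb_nonneg _ _ _ _)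

theorem hypProb_le_hypMode {x : ℕ} (hK : K ≤ N) (hk : k ≤ N) (hx : x ≤ k) :
    hypProb N K k x ≤ hypProb N K k (hypMode N K k) := by
  rcases le_total x (hypMode N K k) with h | h
  · refine Nat.decreasingInduction' (P := fun y => hypProb N K k y ≤ hypProb N K k (hypMode N K k))
      (fun y hy _ ih => (hypProb_le_succ hK hk hy).trans ih) h le_rfl
  · induction x, h using Nat.le_induction with
    | base => exact le_rfl
    | succ y hy ih => exact (hypProb_succ_le hK hy hx).trans (ih (by omega))

/-- Log-concavity: both binomial factors are log-concave, the second one read backwards. -/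
theorem hypProb_mul_le {a s t : ℕ} (h : a + s + t ≤ k) :
    hypProb N K k a * hypProb N K k (a + s + t) ≤
      hypProb N K k (a + s) * hypProb N K k (a + t) := by
  have h1 := choose_mul_choose_le K a s t
  have h2 := choose_mul_choose_le (N - K) (k - (a + s + t)) s t
  rw [show k - (a + s + t) + s + t = k - a by omega,
    show k - (a + s + t) + s = k - (a + t) by omega,
    show k - (a + s + t) + t = k - (a + s) by omega] at h2
  have h3 := Nat.mul_le_mul h1 h2
  unfold hypProb
  rw [div_mul_div_comm, div_mul_div_comm]
  gcongr ?_ / _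
  have h4 : ((K.choose a * K.choose (a + s + t) *
      ((N - K).choose (k - (a + s + t)) * (N - K).choose (k - a)) : ℕ) : ℝ) ≤
      ((K.choose (a + s) * K.choose (a + t) *
      ((N - K).choose (k - (a + t)) * (N - K).choose (k - (a + s))) : ℕ) : ℝ) :=
    Nat.cast_le.2 h3
  push_cast at h4
  linarith

/-- By log-concavity, f(a) f(a + d) ≤ f(a + s) f(a + d - s), so the geometric mean of the end values
is at most the average of each symmetric pair between them. Adding the d + 1 pairs gives at most the
total mass 1. -/
theorem sqrt_hypProb_mul_le {a d : ℕ} (hK : K ≤ N) (hk : k ≤ N) (h : a + d ≤ k) :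
    Real.sqrt (hypProb N K k a * hypProb N K k (a + d)) * (d + 1) ≤ 1 := by
  have hsum : ∑ s ∈ Finset.range (d + 1), hypProb N K k (a + s) ≤ 1 := by
    have e := Finset.sum_Ico_eq_sum_range (hypProb N K k) a (a + (d + 1))
    rw [show a + (d + 1) - a = d + 1 by omega] at e
    rw [← e, ← sum_hypProb hK hk]
    refine Finset.sum_le_sum_of_subset_of_nonneg (fun y hy => ?_) fun y _ _ => hypProb_nonneg _ _ _ _
    simp at hy ⊢; omega
  have hrefl : ∑ s ∈ Finset.range (d + 1), hypProb N K k (a + (d - s)) ≤ 1 := by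
    refine le_of_eq_of_le ?_ hsum
    rw [← Finset.sum_range_reflect]
    exact Finset.sum_congr rfl fun s hs => by
      rw [show d - (d + 1 - 1 - s) = s by simp at hs; omega]
  have hterm : ∀ s ∈ Finset.range (d + 1),
      Real.sqrt (hypProb N K k a * hypProb N K k (a + d)) ≤
        (hypProb N K k (a + s) + hypProb N K k (a + (d - s))) / 2 := by
    intro s hs
    have hs' : s ≤ d := by simp at hs; omega
    have n1 := hypProb_nonneg N K k (a + s)
    have n2 := hypProb_nonneg N K k (a + (d - s))
    have := hypProb_mul_le (N := N) (K := K) (k := k) (a := a) (s := s) (t := d - s) (by omega)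
    rw [show a + s + (d - s) = a + d by omega] at this
    refine Real.sqrt_le_iff.2 ⟨by positivity, this.trans ?_⟩
    nlinarith [sq_nonneg (hypProb N K k (a + s) - hypProb N K k (a + (d - s)))]
  have := Finset.sum_le_sum hterm
  rw [← Finset.sum_div, Finset.sum_add_distrib, Finset.sum_const, Finset.card_range,
    nsmul_eq_mul] at this
  push_cast at this
  linarith

/-- Log-concavity bounds how far from the mode large values can be. -/
theorem sqrt_hypProb_hypMode_mul_le {x : ℕ} (hK : K ≤ N) (hk : k ≤ N) (h : x ≤ k) :
    Real.sqrt (hypProb N K k (hypMode N K k) * hypProb N K k x) *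
      (|(x : ℝ) - hypMode N K k| + 1) ≤ 1 := by
  rcases le_total x (hypMode N K k) with hx | hx
  · obtain ⟨d, hd⟩ := Nat.exists_eq_add_of_le hx
    have := sqrt_hypProb_mul_le (a := x) (d := d) hK hk (by rw [← hd]; exact hypMode_le_left hK)
    rw [hd]
    rw [mul_comm] at this
    simpa [mul_comm] using this
  · obtain ⟨d, hd⟩ := Nat.exists_eq_add_of_le hx
    have := sqrt_hypProb_mul_le (a := hypMode N K k) (d := d) hK hk (by omega)
    rw [← hd] at this
    have e : (x : ℝ) - hypMode N K k = d := by rw [hd]; push_cast; ring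
    rw [e, Nat.abs_cast]
    exact this

end

noncomputable section

/-! ## The random source -/

instance : IsProbabilityMeasure sourceMeasure := by unfold sourceMeasure; infer_instance

/-- Functions of disjoint sets of variates are independent. -/
theorem lintegral_mul_of_dependsOn {f g : Source → ℝ≥0∞} (hf : Measurable f) (hg : Measurable g)
    {S : Set (ℕ × ℕ)} (hfS : DependsOn f S) (hgS : DependsOn g Sᶜ) :
    ∫⁻ ω, f ω * g ω ∂sourceMeasure =
      (∫⁻ ω, f ω ∂sourceMeasure) * ∫⁻ ω, g ω ∂sourceMeasure := by
  classical
  let M : ℕ × ℕ → MeasurableSpace Source := fun i =>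
    MeasurableSpace.comap (fun ω : Source => ω i) inferInstance
  have hle : ∀ i, M i ≤ (inferInstance : MeasurableSpace Source) := fun i =>
    (measurable_pi_apply i).comap_le
  have hind : ProbabilityTheory.iIndep M sourceMeasure :=
    (ProbabilityTheory.iIndepFun_infinitePi (P := fun _ : ℕ × ℕ => (volume : Measure unitInterval))
      (X := fun _ => id) (fun _ => measurable_id)).iIndep
  have hST : Disjoint S Sᶜ := disjoint_compl_right
  have hmeas : ∀ (T : Set (ℕ × ℕ)) (h : Source → ℝ≥0∞), Measurable h → DependsOn h T →
      Measurable[⨆ i ∈ T, M i] h := by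
    intro T h hh hT
    -- Resetting the coordinates outside T does not change h, and the resetting map is measurable
    -- for the σ-algebra generated by the coordinates in T.
    have e : h = h ∘ fun (ω : Source) i => if i ∈ T then ω i else 0 := by
      funext ω
      exact hT fun i hi => by simp [hi]
    rw [e]
    refine hh.comp ?_
    refine @measurable_pi_lambda _ _ _ (⨆ i ∈ T, M i) _ _ fun i => ?_
    by_cases hi : i ∈ T
    · simp only [hi, if_true]
      have h1 : Measurable[M i] fun ω : Source => ω i := comap_measurable _
      exact h1.mono (le_iSup₂_of_le i hi le_rfl) le_rfl
    · simp only [hi, if_false]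
      exact @measurable_const _ _ _ (⨆ i ∈ T, M i) _
  exact ProbabilityTheory.lintegral_mul_eq_lintegral_mul_lintegral_of_independent_measurableSpace
    (iSup₂_le fun i _ => hle i) (iSup₂_le fun i _ => hle i)
    (ProbabilityTheory.indep_iSup_of_disjoint hle hind hST)
    (hmeas _ _ hf hfS) (hmeas _ _ hg hgS)

/-- The `j`-th pair of variates of the seed `s`. -/
def pairAt (ω : Source) (s j : ℕ) : unitInterval × unitInterval := (ω (s, 2 * j), ω (s, 2 * j + 1))

/-- The positions of the first `j` pairs of variates of the seed `s`. -/
def pairsBefore (s j : ℕ) : Set (ℕ × ℕ) := {a | a.1 = s ∧ a.2 < 2 * j}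

theorem measurable_pairAt (s j : ℕ) : Measurable fun ω => pairAt ω s j := by
  unfold pairAt; fun_prop

theorem lintegral_pairAt (s j : ℕ) {f : unitInterval × unitInterval → ℝ≥0∞} (hf : Measurable f) :
    ∫⁻ ω, f (pairAt ω s j) ∂sourceMeasure = ∫⁻ z, f z := by
  have h := Measure.infinitePi_map_eval_prod
    (P := fun _ : ℕ × ℕ => (volume : Measure unitInterval)) (i := (s, 2 * j)) (j := (s, 2 * j + 1))
    (by simp)
  rw [Measure.volume_eq_prod, ← h, lintegral_map hf (by fun_prop)]
  rfl

theorem pairAt_eq {ω ω' : Source} {s i j : ℕ} (h : ∀ a ∈ pairsBefore s j, ω a = ω' a)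
    (hi : i < j) : pairAt ω s i = pairAt ω' s i := by
  unfold pairAt
  rw [h (s, 2 * i) ⟨rfl, by simp; omega⟩, h (s, 2 * i + 1) ⟨rfl, by simp; omega⟩]

theorem lintegral_prod_mul_pairAt (s j : ℕ) {f g : unitInterval × unitInterval → ℝ≥0∞}
    (hf : Measurable f) (hg : Measurable g) :
    ∫⁻ ω, (∏ i ∈ Finset.range j, f (pairAt ω s i)) * g (pairAt ω s j) ∂sourceMeasure =
      (∫⁻ z, f z) ^ j * ∫⁻ z, g z := by
  -- The pair j is independent of the earlier ones. Splitting it off with g = f repeatedly yields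
  -- the power.
  have key : ∀ j (g : unitInterval × unitInterval → ℝ≥0∞), Measurable g →
      ∫⁻ ω, (∏ i ∈ Finset.range j, f (pairAt ω s i)) * g (pairAt ω s j) ∂sourceMeasure =
      (∫⁻ ω, ∏ i ∈ Finset.range j, f (pairAt ω s i) ∂sourceMeasure) * ∫⁻ z, g z := by
    intro j g hg
    rw [lintegral_mul_of_dependsOn (S := pairsBefore s j)
      (f := fun ω => ∏ i ∈ Finset.range j, f (pairAt ω s i)) (g := fun ω => g (pairAt ω s j))
      (Finset.measurable_fun_prod _ fun i _ => hf.comp (measurable_pairAt s i))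
      (hg.comp (measurable_pairAt s j)) ?_ ?_, lintegral_pairAt s j hg]
    · intro ω ω' h
      exact Finset.prod_congr rfl fun i hi => by rw [pairAt_eq h (Finset.mem_range.1 hi)]
    · intro ω ω' h
      have : pairAt ω s j = pairAt ω' s j := by
        unfold pairAt
        rw [h (s, 2 * j) (by simp [pairsBefore]), h (s, 2 * j + 1) (by simp [pairsBefore])]
      simp only [this]
  rw [key j g hg]
  congr 1
  clear hg g
  induction j with
  | zero => simp
  | succ j ih =>
    simp only [Finset.prod_range_succ]
    rw [key j f hf, ih, pow_succ]

/-! ## Acceptance probability of the ratio of uniforms -/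

/-- The candidate for a hypergeometric variate that is computed from a pair of variates. -/
def hypCandidate (N K k : ℕ) (z : unitInterval × unitInterval) : ℤ :=
  ⌊(hypMode N K k : ℝ) + 1 / 2 +
    (2 * (z.2 : ℝ) - 1) * (2 / hypProb N K k (hypMode N K k)) / (z.1 : ℝ)⌋

/-- The pairs of variates for which the value `x` is accepted. -/
def hypAccept (N K k x : ℕ) : Set (unitInterval × unitInterval) :=
  {z | hypCandidate N K k z = x ∧ k + K ≤ N + x ∧ x ≤ k ∧ x ≤ K ∧
    (z.1 : ℝ) * z.1 * hypProb N K k (hypMode N K k) ≤ hypProb N K k x}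

/-- The pairs of variates that are rejected. -/
def hypReject (N K k : ℕ) : Set (unitInterval × unitInterval) := {z | ∀ x, z ∉ hypAccept N K k x}

theorem measurableSet_hypAccept (N K k x : ℕ) : MeasurableSet (hypAccept N K k x) := by
  have h1 : Measurable (hypCandidate N K k) := by
    unfold hypCandidate
    exact Int.measurable_floor.comp (by fun_prop)
  have h2 : MeasurableSet {z | hypCandidate N K k z = x} := h1 (measurableSet_singleton _)
  have h3 : MeasurableSet {z : unitInterval × unitInterval |
      (z.1 : ℝ) * z.1 * hypProb N K k (hypMode N K k) ≤ hypProb N K k x} :=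
    measurableSet_le (by fun_prop) (by fun_prop)
  exact h2.inter ((MeasurableSet.const _).inter ((MeasurableSet.const _).inter
    ((MeasurableSet.const _).inter h3)))

theorem measurableSet_hypReject (N K k : ℕ) : MeasurableSet (hypReject N K k) := by
  have : hypReject N K k = ⋂ x, (hypAccept N K k x)ᶜ := by ext; simp [hypReject]
  rw [this]
  exact MeasurableSet.iInter fun x => (measurableSet_hypAccept N K k x).compl

theorem volume_Ico_unitInterval {a b : ℝ} (ha : 0 ≤ a) (hb : b ≤ 1) (hab : a ≤ b) :
    volume {v : unitInterval | a ≤ v ∧ (v : ℝ) < b} = ENNReal.ofReal (b - a) := by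
  have := unitInterval.volume_Ico ⟨a, ha, hab.trans hb⟩ ⟨b, ha.trans hab, hb⟩
  rw [← this]
  rfl

theorem lintegral_linear_unitInterval {c r : ℝ} (hc : 0 ≤ c) (hr0 : 0 ≤ r) (hr1 : r ≤ 1) :
    ∫⁻ u : unitInterval, (if (u : ℝ) ≤ r then ENNReal.ofReal (c * u) else 0) =
      ENNReal.ofReal (c * r ^ 2 / 2) := by
  have h1 : ∀ u : unitInterval, (if (u : ℝ) ≤ r then ENNReal.ofReal (c * u) else 0) =
      (Set.Iic (⟨r, hr0, hr1⟩ : unitInterval)).indicator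
        (fun u : unitInterval => ENNReal.ofReal (c * u)) u := by
    intro u
    have : (u : ℝ) ≤ r ↔ u ∈ Set.Iic (⟨r, hr0, hr1⟩ : unitInterval) := Iff.rfl
    simp only [Set.indicator, this]
  simp only [h1]
  rw [lintegral_indicator measurableSet_Iic, unitInterval.volume_def]
  rw [setLIntegral_subtype measurableSet_Icc _ (fun u : ℝ => ENNReal.ofReal (c * u))]
  rw [Set.image_subtype_val_Icc_Iic]
  simp only
  rw [← ofReal_integral_eq_lintegral_ofReal]
  · congr 1
    rw [integral_Icc_eq_integral_Ioc, ← intervalIntegral.integral_of_le hr0,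
      intervalIntegral.integral_const_mul, integral_id]
    ring
  · exact (Continuous.integrableOn_Icc (by fun_prop))
  · refine (ae_restrict_iff' measurableSet_Icc).2 (Filter.Eventually.of_forall fun u hu => ?_)
    exact mul_nonneg hc hu.1

variable {N K k : ℕ}

theorem hypCandidate_eq_iff {u v : unitInterval} (hu : (0 : ℝ) < u)
    (hp : 0 < hypProb N K k (hypMode N K k)) (x : ℤ) :
    hypCandidate N K k (u, v) = x ↔
      1 / 2 + ((x : ℝ) - hypMode N K k - 1 / 2) * (hypProb N K k (hypMode N K k) * u / 4) ≤ v ∧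
      (v : ℝ) <
        1 / 2 + ((x : ℝ) - hypMode N K k + 1 / 2) * (hypProb N K k (hypMode N K k) * u / 4) := by
  unfold hypCandidate
  set p := hypProb N K k (hypMode N K k)
  have hc : 0 < p * u / 4 := by positivity
  have e : (2 * (v : ℝ) - 1) * (2 / p) / u = ((v : ℝ) - 1 / 2) / (p * u / 4) := by
    field_simp
    ring
  rw [Int.floor_eq_iff]
  simp only
  rw [e, ← sub_le_iff_le_add', ← lt_sub_iff_add_lt', le_div_iff₀ hc, div_lt_iff₀ hc]
  constructor
  · rintro ⟨h1, h2⟩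
    constructor <;> nlinarith
  · rintro ⟨h1, h2⟩
    constructor <;> nlinarith

/-- Fubini: for u ≤ r = √(f/p) the slice in v is an interval of length pu/4, and it lies in [0, 1]
by the log-concavity bound. The integral is p r² / 8 = f/8, so acceptance preserves the proportions
of f exactly. -/
theorem volume_hypAccept {x : ℕ} (hK : K ≤ N) (hk : k ≤ N) (hx : x ≤ k) :
    volume (hypAccept N K k x) = ENNReal.ofReal (hypProb N K k x / 8) := by
  by_cases hs : k + K ≤ N + x ∧ x ≤ K
  swap
  · rw [hypProb_eq_zero hK hx hs]
    have : hypAccept N K k x = ∅ := by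
      ext z
      simp only [hypAccept, Set.mem_ofPred_eq, Set.mem_empty_iff_false, iff_false]
      tauto
    simp [this]
  have hp := hypProb_hypMode_pos hK hk
  have hf := hypProb_nonneg N K k x
  have hfp := hypProb_le_hypMode hK hk hx
  have hd := sqrt_hypProb_hypMode_mul_le hK hk hx
  set p := hypProb N K k (hypMode N K k) with hpdef
  set f := hypProb N K k x
  set r := Real.sqrt (f / p) with hr
  have hr0 : 0 ≤ r := Real.sqrt_nonneg _
  have hr1 : r ≤ 1 := Real.sqrt_le_one.2 ((div_le_one hp).2 hfp)
  have hpr : p * r = Real.sqrt (p * f) := by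
    symm
    rw [hr, Real.sqrt_eq_iff_mul_self_eq (by positivity) (by positivity)]
    have := Real.mul_self_sqrt (show 0 ≤ f / p by positivity)
    rw [show p * √(f / p) * (p * √(f / p)) = p * p * (√(f / p) * √(f / p)) by ring, this]
    field_simp
  rw [Measure.volume_eq_prod, Measure.prod_apply (measurableSet_hypAccept N K k x)]
  have hslice : ∀ᵐ u : unitInterval, volume (Prod.mk u ⁻¹' hypAccept N K k x) =
      if (u : ℝ) ≤ r then ENNReal.ofReal (p / 4 * u) else 0 := by
    -- At u = 0 the candidate is computed by a division by zero; this is a null set.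
    have h0 : ∀ᵐ u : unitInterval, u ≠ 0 := by
      simp [ae_iff]
    filter_upwards [h0] with u hu0
    have hu : (0 : ℝ) < u := unitInterval.pos_iff_ne_zero.2 hu0
    have hiff : (u : ℝ) * u * p ≤ f ↔ (u : ℝ) ≤ r := by
      rw [hr, Real.le_sqrt' hu, le_div_iff₀ hp, sq]
    split_ifs with hur
    · have hset : Prod.mk u ⁻¹' hypAccept N K k x = {v : unitInterval |
          1 / 2 + ((x : ℝ) - hypMode N K k - 1 / 2) * (p * u / 4) ≤ v ∧
          (v : ℝ) < 1 / 2 + ((x : ℝ) - hypMode N K k + 1 / 2) * (p * u / 4)} := by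
        ext v
        have := hypCandidate_eq_iff (v := v) hu hp x
        simp only [Int.cast_natCast] at this
        simp only [Set.mem_preimage, hypAccept, Set.mem_ofPred_eq, this, ← hpdef]
        constructor
        · exact fun h => h.1
        · exact fun h => ⟨h, hs.1, hx, hs.2, hiff.2 hur⟩
      -- As u ≤ r and p r = √(p f). This keeps both ends of the slice within [0, 1].
      have hb : p * u * (|(x : ℝ) - hypMode N K k| + 1) ≤ 1 := by
        refine le_trans ?_ hd
        rw [← hpr]
        gcongr
      have habs := abs_le.1 (le_refl |(x : ℝ) - hypMode N K k|)
      have hpu : 0 < p * u := by positivity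
      rw [hset, volume_Ico_unitInterval]
      · congr 1; ring
      · nlinarith [mul_le_mul_of_nonneg_left habs.1 hpu.le]
      · nlinarith [mul_le_mul_of_nonneg_left habs.2 hpu.le]
      · nlinarith
    · have : Prod.mk u ⁻¹' hypAccept N K k x = ∅ := by
        ext v
        simp only [Set.mem_preimage, hypAccept, Set.mem_ofPred_eq, Set.mem_empty_iff_false, iff_false]
        exact fun h => hur (hiff.1 h.2.2.2.2)
      simp [this]
  rw [lintegral_congr_ae hslice, lintegral_linear_unitInterval (by positivity) hr0 hr1]
  congr 1
  rw [hr, Real.sq_sqrt (by positivity)]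
  field_simp
  ring

theorem volume_hypReject (hK : K ≤ N) (hk : k ≤ N) :
    volume (hypReject N K k) = ENNReal.ofReal (7 / 8) := by
  have hU : (hypReject N K k)ᶜ = ⋃ x ∈ Finset.range (k + 1), hypAccept N K k x := by
    ext z
    simp only [hypReject, Set.mem_compl_iff, Set.mem_ofPred_eq, not_forall, not_not, Set.mem_iUnion,
      Finset.mem_range, exists_prop]
    constructor
    · rintro ⟨x, hx⟩
      exact ⟨x, Nat.lt_succ_of_le hx.2.2.1, hx⟩
    · rintro ⟨x, -, hx⟩
      exact ⟨x, hx⟩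
  have hcompl : volume (hypReject N K k)ᶜ = ENNReal.ofReal (1 / 8) := by
    rw [hU, measure_biUnion_finset ?_ fun x _ => measurableSet_hypAccept N K k x]
    · rw [Finset.sum_congr rfl fun x hx => volume_hypAccept hK hk
        (Nat.lt_succ_iff.1 (Finset.mem_range.1 hx)), ← ENNReal.ofReal_sum_of_nonneg
        fun x _ => div_nonneg (hypProb_nonneg _ _ _ _) (by norm_num), ← Finset.sum_div,
        sum_hypProb hK hk]
    · intro x _ y _ hxy
      refine Set.disjoint_left.2 fun z hz hz' => hxy ?_
      exact_mod_cast hz.1.symm.trans hz'.1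
  have h := prob_compl_eq_one_sub (μ := (volume : Measure (unitInterval × unitInterval)))
    (measurableSet_hypReject N K k).compl
  rw [compl_compl, hcompl] at h
  rw [h, ← ENNReal.ofReal_one, ← ENNReal.ofReal_sub _ (by norm_num)]
  norm_num

/-- Indicator of the event that the first `j` pairs of variates of the seed `s` are rejected, and
the next one is accepted with the value `x`. -/
def firstAccept (N K k s j x : ℕ) (ω : Source) : ℝ≥0∞ :=
  (∏ i ∈ Finset.range j, (hypReject N K k).indicator 1 (pairAt ω s i)) *
    (hypAccept N K k x).indicator 1 (pairAt ω s j)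

theorem measurable_firstAccept (N K k s j x : ℕ) : Measurable (firstAccept N K k s j x) :=
  (Finset.measurable_fun_prod _ fun i _ =>
    ((measurable_one.indicator (measurableSet_hypReject N K k)).comp (measurable_pairAt s i))).mul
    ((measurable_one.indicator (measurableSet_hypAccept N K k x)).comp (measurable_pairAt s j))

theorem lintegral_firstAccept (s j : ℕ) {x : ℕ} (hK : K ≤ N) (hk : k ≤ N) (hx : x ≤ k) :
    ∫⁻ ω, firstAccept N K k s j x ω ∂sourceMeasure =
      ENNReal.ofReal ((7 / 8) ^ j * (hypProb N K k x / 8)) := by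
  unfold firstAccept
  rw [lintegral_prod_mul_pairAt s j (measurable_one.indicator (measurableSet_hypReject N K k))
    (measurable_one.indicator (measurableSet_hypAccept N K k x)),
    lintegral_indicator_one (measurableSet_hypReject N K k),
    lintegral_indicator_one (measurableSet_hypAccept N K k x), volume_hypReject hK hk,
    volume_hypAccept hK hk hx, ENNReal.ofReal_mul (by positivity), ENNReal.ofReal_pow (by norm_num)]

/-- The first j pairs are all rejected with probability (7/8)^j, which tends to 0. There are
countably many parameters and seeds, so one null set serves all; off it the execution can be
followed for a fixed source. -/
theorem ae_exists_accept : ∀ᵐ ω ∂sourceMeasure, ∀ N K k s : ℕ, K ≤ N → k ≤ N →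
    ∃ j, pairAt ω s j ∉ hypReject N K k := by
  refine ae_all_iff.2 fun N => ae_all_iff.2 fun K => ae_all_iff.2 fun k => ae_all_iff.2 fun s =>
    Filter.eventually_imp_distrib_left.2 fun hK => Filter.eventually_imp_distrib_left.2 fun hk => ?_
  have hle : ∀ j : ℕ, sourceMeasure {ω | ¬ ∃ j, pairAt ω s j ∉ hypReject N K k} ≤
      ENNReal.ofReal (7 / 8) ^ j := by
    intro j
    have h := lintegral_prod_mul_pairAt s j
      (measurable_one.indicator (measurableSet_hypReject N K k)) (measurable_const (a := 1))
    rw [lintegral_indicator_one (measurableSet_hypReject N K k), volume_hypReject hK hk] at h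
    simp only [mul_one, lintegral_const, measure_univ] at h
    rw [← h]
    have h1 := mul_meas_ge_le_lintegral (μ := sourceMeasure) (f := fun ω =>
      ∏ i ∈ Finset.range j, (hypReject N K k).indicator (fun _ => (1 : ℝ≥0∞)) (pairAt ω s i))
      (Finset.measurable_fun_prod _ fun i _ =>
      ((measurable_one.indicator (measurableSet_hypReject N K k)).comp (measurable_pairAt s i))) 1
    rw [one_mul] at h1
    refine (measure_mono fun ω hω => ?_).trans h1
    simp only [Set.mem_ofPred_eq, not_exists, not_not] at hω ⊢
    simp [hω]
  rw [ae_iff]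
  refine le_antisymm (ge_of_tendsto' (ENNReal.tendsto_pow_atTop_nhds_zero_of_lt_one ?_) hle) zero_le
  rw [ENNReal.ofReal_lt_one]; norm_num

/-! ## Pairs of variates with which a skip is accepted -/

/-- Pairs of variates with which every skip is accepted. -/
def skipAccept : Set (unitInterval × unitInterval) := {z | (2 / 3 : ℝ) ≤ z.1 ∧ (z.2 : ℝ) ≤ 2 / 5}

open Classical in
/-- Number of pairs in `skipAccept` among the pairs `i, …, j - 1` of the seed `s`. -/
def skipCount (ω : Source) (s i j : ℕ) : ℕ :=
  ((Finset.Ico i j).filter fun a => pairAt ω s a ∈ skipAccept).card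

theorem skipAccept_eq : skipAccept =
    Set.Ici (⟨2 / 3, by norm_num, by norm_num⟩ : unitInterval) ×ˢ
      Set.Iic (⟨2 / 5, by norm_num, by norm_num⟩ : unitInterval) := rfl

theorem measurableSet_skipAccept : MeasurableSet skipAccept := by
  rw [skipAccept_eq]; exact measurableSet_Ici.prod measurableSet_Iic

theorem volume_skipAccept : volume skipAccept = ENNReal.ofReal (2 / 15) := by
  rw [skipAccept_eq, Measure.volume_eq_prod, Measure.prod_prod, unitInterval.volume_Ici,
    unitInterval.volume_Iic, ← ENNReal.ofReal_mul (by norm_num)]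
  norm_num

open Classical in
/-- Lower tail of the number of pairs in `skipAccept`. -/
theorem measure_skipCount_lt_le (s B : ℕ) :
    sourceMeasure {ω | skipCount ω s 0 (30 * B) < B} ≤ ENNReal.ofReal (Real.exp (-B)) := by
  -- Chernoff weight 1/2 for each good pair: its mean is 1 - (2/15)/2 = 14/15.
  let w : unitInterval × unitInterval → ℝ≥0∞ := fun z =>
    ENNReal.ofReal (if z ∈ skipAccept then 1 / 2 else 1)
  have hw : Measurable w := ENNReal.measurable_ofReal.comp
    (Measurable.ite measurableSet_skipAccept measurable_const measurable_const)
  have hw1 : ∫⁻ z, w z = ENNReal.ofReal (14 / 15) := by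
    have e : ∀ z, w z = (skipAccept.indicator (fun _ => ENNReal.ofReal (1 / 2)) z) +
        (skipAcceptᶜ.indicator (fun _ => (1 : ℝ≥0∞)) z) := by
      intro z
      by_cases hz : z ∈ skipAccept <;> simp [w, hz]
    simp only [e]
    rw [lintegral_add_left (measurable_const.indicator measurableSet_skipAccept),
      lintegral_indicator_const measurableSet_skipAccept,
      lintegral_indicator_const measurableSet_skipAccept.compl,
      prob_compl_eq_one_sub measurableSet_skipAccept, volume_skipAccept, ← ENNReal.ofReal_one,
      ← ENNReal.ofReal_sub _ (by norm_num), ← ENNReal.ofReal_mul (by norm_num),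
      ← ENNReal.ofReal_mul (by norm_num), ← ENNReal.ofReal_add (by norm_num) (by norm_num)]
    norm_num
  have h := lintegral_prod_mul_pairAt s (30 * B) hw (measurable_const (a := (1 : ℝ≥0∞)))
  simp only [mul_one, lintegral_const, measure_univ, hw1] at h
  have hprod : ∀ ω, ∏ i ∈ Finset.range (30 * B), w (pairAt ω s i) =
      ENNReal.ofReal ((1 / 2) ^ skipCount ω s 0 (30 * B)) := by
    intro ω
    simp only [w]
    rw [← ENNReal.ofReal_prod_of_nonneg fun i _ => by split_ifs <;> norm_num]
    congr 1
    rw [Finset.prod_ite, Finset.prod_const, Finset.prod_const_one, mul_one, skipCount,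
      Finset.range_eq_Ico]
  simp only [hprod] at h
  have hm : Measurable fun ω => ENNReal.ofReal ((1 / 2) ^ skipCount ω s 0 (30 * B)) := by
    simp only [← hprod]
    exact Finset.measurable_fun_prod _ fun i _ => hw.comp (measurable_pairAt s i)
  have h1 := meas_ge_le_lintegral_div (μ := sourceMeasure) hm.aemeasurable
    (ε := ENNReal.ofReal ((1 / 2) ^ B)) (by simp) (by simp)
  rw [h, ← ENNReal.ofReal_pow (by norm_num), ← ENNReal.ofReal_div_of_pos (by positivity)] at h1
  refine (measure_mono fun ω hω => ?_).trans (h1.trans (ENNReal.ofReal_le_ofReal ?_))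
  · exact ENNReal.ofReal_le_ofReal (pow_le_pow_of_le_one (by norm_num) (by norm_num) (le_of_lt hω))
  -- Why 30 pairs per required success: 30/15 = 2 gives e^(-2B), of which the Markov factor 2^B ≤
  -- e^B consumes half of the exponent.
  · have e1 : (14 / 15 : ℝ) ^ (30 * B) ≤ Real.exp (-2 * B) := by
      have : (14 / 15 : ℝ) ≤ Real.exp (-(1 / 15)) := by
        have := Real.add_one_le_exp (-(1 / 15) : ℝ); linarith
      calc (14 / 15 : ℝ) ^ (30 * B) ≤ Real.exp (-(1 / 15)) ^ (30 * B) := by gcongr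
        _ = Real.exp (-2 * B) := by rw [← Real.exp_nat_mul]; congr 1; push_cast; ring
    have e2 : (2 : ℝ) ^ B ≤ Real.exp B := by
      have : (2 : ℝ) ≤ Real.exp 1 := by have := Real.add_one_le_exp (1 : ℝ); linarith
      calc (2 : ℝ) ^ B ≤ Real.exp 1 ^ B := by gcongr
        _ = Real.exp B := by rw [← Real.exp_nat_mul]; simp
    calc (14 / 15 : ℝ) ^ (30 * B) / (1 / 2) ^ B = (14 / 15 : ℝ) ^ (30 * B) * 2 ^ B := by
          rw [one_div, inv_pow, div_inv_eq_mul]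
      _ ≤ Real.exp (-2 * B) * Real.exp B := by gcongr
      _ = Real.exp (-B) := by rw [← Real.exp_add]; congr 1; ring

end

noncomputable section

/-! ## Weakest preconditions -/

/-- The program `c`, started in the state `s`, halts after a time `T` in a state `s'` with
`Q T s'`. -/
def Wp (ω : Source) (c : Cmd) (s : State) (Q : ℕ → State → Prop) : Prop :=
  ∃ T s', Exec ω c s T s' ∧ Q T s'

section Wp

variable {ω : Source} {s : State} {Q : ℕ → State → Prop}

theorem Wp.mono {c : Cmd} {Q' : ℕ → State → Prop} (h : Wp ω c s Q)
    (hQ : ∀ T s', Q T s' → Q' T s') : Wp ω c s Q' := by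
  obtain ⟨T, s', h1, h2⟩ := h
  exact ⟨T, s', h1, hQ _ _ h2⟩

theorem wp_skip : Wp ω .skip s Q ↔ Q 1 s := by
  constructor
  · rintro ⟨_, _, ⟨⟩, h⟩; exact h
  · exact fun h => ⟨_, _, .skip s, h⟩

theorem wp_assign {r : Var} {e : Expr} : Wp ω (.assign r e) s Q ↔
    Q (e.cost + 1) { s with reg := Function.update s.reg r (e.eval s.reg) } := by
  constructor
  · rintro ⟨_, _, ⟨⟩, h⟩; exact h
  · exact fun h => ⟨_, _, .assign r e s, h⟩

theorem wp_seed {e : Expr} : Wp ω (.seed e) s Q ↔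
    Q (e.cost + 1) { s with seed := ⌊e.eval s.reg⌋₊, drawn := 0 } := by
  constructor
  · rintro ⟨_, _, ⟨⟩, h⟩; exact h
  · exact fun h => ⟨_, _, .seed e s, h⟩

theorem wp_draw {r : Var} : Wp ω (.draw r) s Q ↔
    Q 1 { s with
      reg := Function.update s.reg r (ω (s.seed, s.drawn) : ℝ)
      drawn := s.drawn + 1 } := by
  constructor
  · rintro ⟨_, _, ⟨⟩, h⟩; exact h
  · exact fun h => ⟨_, _, .draw r s, h⟩

theorem wp_emitVertex {e : Expr} : Wp ω (.emitVertex e) s Q ↔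
    Q (e.cost + 1) { s with vertices := ⌊e.eval s.reg⌋₊ :: s.vertices } := by
  constructor
  · rintro ⟨_, _, ⟨⟩, h⟩; exact h
  · exact fun h => ⟨_, _, .emitVertex e s, h⟩

theorem wp_emitEdge {e e' : Expr} : Wp ω (.emitEdge e e') s Q ↔
    Q (e.cost + e'.cost + 1)
      { s with edges := (⌊e.eval s.reg⌋₊, ⌊e'.eval s.reg⌋₊) :: s.edges } := by
  constructor
  · rintro ⟨_, _, ⟨⟩, h⟩; exact h
  · exact fun h => ⟨_, _, .emitEdge e e' s, h⟩

theorem wp_seq {c d : Cmd} : Wp ω (.seq c d) s Q ↔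
    Wp ω c s fun T s' => Wp ω d s' fun T' s'' => Q (T + T') s'' := by
  constructor
  · rintro ⟨_, _, h, hQ⟩
    cases h with
    | seq h1 h2 => exact ⟨_, _, h1, _, _, h2, hQ⟩
  · rintro ⟨_, _, h1, _, _, h2, hQ⟩
    exact ⟨_, _, .seq h1 h2, hQ⟩

theorem wp_ite_pos {b : Test} {c d : Cmd} (hb : b.Holds s.reg)
    (h : Wp ω c s fun T s' => Q (b.cost + T + 1) s') : Wp ω (.ite b c d) s Q := by
  obtain ⟨_, _, h1, h2⟩ := h
  exact ⟨_, _, .iteTrue hb h1, h2⟩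

theorem wp_ite_neg {b : Test} {c d : Cmd} (hb : ¬ b.Holds s.reg)
    (h : Wp ω d s fun T s' => Q (b.cost + T + 1) s') : Wp ω (.ite b c d) s Q := by
  obtain ⟨_, _, h1, h2⟩ := h
  exact ⟨_, _, .iteFalse hb h1, h2⟩

theorem wp_while_pos {b : Test} {c : Cmd} (hb : b.Holds s.reg)
    (h : Wp ω c s fun T s' => Wp ω (.while b c) s' fun T' s'' => Q (b.cost + T + T' + 1) s'') :
    Wp ω (.while b c) s Q := by
  obtain ⟨_, _, h1, _, _, h2, h3⟩ := h
  exact ⟨_, _, .whileTrue hb h1 h2, h3⟩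

theorem wp_while_neg {b : Test} {c : Cmd} (hb : ¬ b.Holds s.reg) (h : Q (b.cost + 1) s) :
    Wp ω (.while b c) s Q :=
  ⟨_, _, .whileFalse hb, h⟩

end Wp

/-! ## Values and costs of expressions -/

section Eval

variable {σ : Var → ℝ} (a b : Expr)

theorem eval_add : (a + b).eval σ = a.eval σ + b.eval σ := rfl
theorem eval_sub : (a - b).eval σ = a.eval σ - b.eval σ := rfl
theorem eval_mul : (a * b).eval σ = a.eval σ * b.eval σ := rfl
theorem eval_div : (a / b).eval σ = a.eval σ / b.eval σ := rfl
theorem eval_zero : (0 : Expr).eval σ = 0 := Nat.cast_zero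
theorem eval_one : (1 : Expr).eval σ = 1 := Nat.cast_one
theorem eval_two : (2 : Expr).eval σ = 2 := Nat.cast_ofNat
theorem eval_thirteen : (13 : Expr).eval σ = 13 := Nat.cast_ofNat
theorem eval_var (r : Var) : (Expr.var r).eval σ = σ r := rfl
theorem eval_floor : (Expr.floor a).eval σ = (⌊a.eval σ⌋ : ℝ) := rfl
theorem eval_exp : (Expr.exp a).eval σ = Real.exp (a.eval σ) := rfl
theorem eval_log : (Expr.log a).eval σ = Real.log (a.eval σ) := rfl
theorem holds_lt : (Test.lt a b).Holds σ ↔ a.eval σ < b.eval σ := Iff.rfl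
theorem holds_le : (Test.le a b).Holds σ ↔ a.eval σ ≤ b.eval σ := Iff.rfl
theorem holds_and (p q : Test) : (Test.and p q).Holds σ ↔ p.Holds σ ∧ q.Holds σ := Iff.rfl

variable {a b}

theorem eval_logChoose {A B : ℕ} (ha : a.eval σ = A) (hb : b.eval σ = B) (h : B ≤ A) :
    (logChoose a b).eval σ = Real.log (A.choose B) := by
  have e : (logChoose a b).eval σ = Real.log (Nat.factorial ⌊a.eval σ⌋₊ : ℝ) -
      Real.log (Nat.factorial ⌊b.eval σ⌋₊ : ℝ) -
      Real.log (Nat.factorial ⌊a.eval σ - b.eval σ⌋₊ : ℝ) := rfl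
  rw [e, ha, hb, ← Nat.cast_sub h, Nat.floor_natCast, Nat.floor_natCast, Nat.floor_natCast,
    Nat.choose_eq_factorial_div_factorial h,
    Nat.cast_div (Nat.factorial_mul_factorial_dvd_factorial h) (by positivity), Nat.cast_mul,
    Real.log_div (by positivity) (by positivity), Real.log_mul (by positivity) (by positivity)]
  ring

theorem exp_eval_logHyp {z : Expr} {N' K' k' x' : ℕ} (hK : K' ≤ N') (hk : k' ≤ N')
    (h1 : k' + K' ≤ N' + x') (h2 : x' ≤ k') (h3 : x' ≤ K') (eN : σ .N = N') (eK : σ .K = K')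
    (ek : σ .k = k') (ez : z.eval σ = x') :
    Real.exp ((logHyp z).eval σ) = hypProb N' K' k' x' := by
  have e : (logHyp z).eval σ = (logChoose K z).eval σ + (logChoose (N - K) (k - z)).eval σ -
    (logChoose N k).eval σ := rfl
  rw [e, eval_logChoose (a := K) (b := z) (A := K') (B := x') eK ez h3,
    eval_logChoose (A := N' - K') (B := k' - x') (by rw [eval_sub, eval_var, eval_var, eN, eK,
      Nat.cast_sub hK]) (by rw [eval_sub, eval_var, ek, ez, Nat.cast_sub h2]) (by omega),
    eval_logChoose (a := N) (b := k) (A := N') (B := k') eN ek hk, Real.exp_sub, Real.exp_add, Real.exp_log,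
    Real.exp_log, Real.exp_log]
  · rfl
  · exact_mod_cast Nat.choose_pos hk
  · exact_mod_cast Nat.choose_pos (show k' - x' ≤ N' - K' by omega)
  · exact_mod_cast Nat.choose_pos h3

end Eval

/-- The states `s` and `s'` agree in the registers outside `l`. -/
def SameOff (l : List Var) (s s' : State) : Prop := ∀ r, r ∉ l → s'.reg r = s.reg r

/-! ## Hypergeometric variates -/

/-- The acceptance test of the hypergeometric distribution. -/
def hypTest : Test :=
  0 ≼ x & k + K - N ≼ x & x ≼ k & x ≼ K & u * u * pMode ≼ .exp (logHyp x)

/-- One round of acceptance-rejection for the hypergeometric distribution. -/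
def hypRound : Cmd :=
  .draw .u ;;
  .draw .v ;;
  .x ::= .floor (mode + 1 / 2 + (2 * v - 1) * (2 / pMode) / u) ;;
  .ite hypTest (.done ::= 1) .skip

section Hypergeometric

variable {ω : Source} {s : State} {N' K' k' : ℕ}

/-- Outside the support, `logHyp` need not represent the mass function, but then one of the range
conditions of the conjunction fails. Inside the support the log-factorials give the mass function
exactly. -/
theorem hypTest_holds_iff {σ : Var → ℝ} {z : unitInterval × unitInterval} (hK : K' ≤ N')
    (hk : k' ≤ N') (eN : σ .N = N') (eK : σ .K = K') (ek : σ .k = k')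
    (ep : σ .pMode = hypProb N' K' k' (hypMode N' K' k')) (eu : σ .u = z.1)
    (ex : σ .x = hypCandidate N' K' k' z) :
    hypTest.Holds σ ↔ ∃ x', z ∈ hypAccept N' K' k' x' := by
  simp only [hypTest, holds_and, holds_le, eval_add, eval_sub, eval_mul, eval_var, eval_zero, eval_one, eval_two,
    eval_exp, eN, eK, ek, ep, eu, ex]
  constructor
  · rintro ⟨h0, h1, h2, h3, h4⟩
    have h0' : 0 ≤ hypCandidate N' K' k' z := by exact_mod_cast h0
    obtain ⟨x', hx'⟩ := Int.eq_ofNat_of_zero_le h0'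
    rw [hx', Int.cast_natCast] at h1 h2 h3
    have g1 : k' + K' ≤ N' + x' := by
      have : (k' : ℝ) + K' ≤ N' + x' := by linarith
      exact_mod_cast this
    have g2 : x' ≤ k' := by exact_mod_cast h2
    have g3 : x' ≤ K' := by exact_mod_cast h3
    rw [exp_eval_logHyp hK hk g1 g2 g3 eN eK ek (by rw [eval_var, ex, hx', Int.cast_natCast])] at h4
    exact ⟨x', hx', g1, g2, g3, h4⟩
  · rintro ⟨x', hx', g1, g2, g3, h4⟩
    rw [exp_eval_logHyp hK hk g1 g2 g3 eN eK ek (by rw [eval_var, ex, hx', Int.cast_natCast]), hx',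
      Int.cast_natCast]
    refine ⟨by positivity, ?_, by exact_mod_cast g2, by exact_mod_cast g3, h4⟩
    have : (k' : ℝ) + K' ≤ N' + x' := by exact_mod_cast g1
    linarith

/-- A round uses exactly two variates, so round j of a seed reads its pair j. This ties the
execution to the events on the source. -/
theorem wp_hypRound {j : ℕ} (hK : K' ≤ N') (hk : k' ≤ N') (eN : s.reg .N = N') (eK : s.reg .K = K')
    (ek : s.reg .k = k') (em : s.reg .mode = hypMode N' K' k')
    (ep : s.reg .pMode = hypProb N' K' k' (hypMode N' K' k')) (ed : s.drawn = 2 * j) :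
    Wp ω hypRound s fun T s' => T ≤ 200 ∧ SameOff [.u, .v, .x, .done] s s' ∧ s'.seed = s.seed ∧
      s'.drawn = 2 * (j + 1) ∧
      (∀ x', pairAt ω s.seed j ∈ hypAccept N' K' k' x' → s'.reg .done = 1 ∧ s'.reg .x = x') ∧
      (pairAt ω s.seed j ∈ hypReject N' K' k' → s'.reg .done = s.reg .done) := by
  simp only [hypRound, wp_seq, wp_draw, wp_assign]
  set σ : Var → ℝ := Function.update (Function.update (Function.update s.reg .u
      (ω (s.seed, s.drawn) : ℝ)) .v (ω (s.seed, s.drawn + 1) : ℝ)) .x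
      (hypCandidate N' K' k' (pairAt ω s.seed j)) with hσ
  have hc : (Expr.floor (mode + 1 / 2 + (2 * v - 1) * (2 / pMode) / u)).eval
      (Function.update (Function.update s.reg .u
      (ω (s.seed, s.drawn) : ℝ)) .v (ω (s.seed, s.drawn + 1) : ℝ)) =
      hypCandidate N' K' k' (pairAt ω s.seed j) := by
    simp [eval_floor, eval_add, eval_sub, eval_mul, eval_div, eval_var, eval_zero, eval_one, eval_two,
      Function.update, em, ep, hypCandidate, pairAt, ed]
  rw [hc]
  have hiff := hypTest_holds_iff (σ := σ) (z := pairAt ω s.seed j) hK hk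
    (by simp [σ, Function.update, eN]) (by simp [σ, Function.update, eK])
    (by simp [σ, Function.update, ek]) (by simp [σ, Function.update, ep])
    (by simp [σ, Function.update, pairAt, ed]) (by simp [σ, Function.update])
  have hcost : hypTest.cost ≤ 100 := by decide
  have hcost' : (Expr.floor (mode + 1 / 2 + (2 * v - 1) * (2 / pMode) / u)).cost ≤ 40 := by decide
  by_cases h : ∃ x', pairAt ω s.seed j ∈ hypAccept N' K' k' x'
  · refine wp_ite_pos (hiff.2 h) (wp_assign.2 ⟨?_, ?_, ?_, ?_, ?_, ?_⟩)
    · have : (1 : Expr).cost = 1 := rfl; omega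
    · intro r hr
      simp at hr
      simp [σ, Function.update, hr]
    · rfl
    · simp [ed]; ring
    · intro x' hx'
      have := hx'.1
      simp [σ, Function.update, eval_zero, eval_one, eval_two, this]
    · intro hrej
      exact absurd h (by push Not; exact hrej)
  · refine wp_ite_neg (mt hiff.1 h) (wp_skip.2 ⟨?_, ?_, ?_, ?_, ?_, ?_⟩)
    · omega
    · intro r hr
      simp at hr
      simp [σ, Function.update, hr]
    · rfl
    · simp [ed]; ring
    · intro x' hx'
      exact absurd ⟨x', hx'⟩ h
    · intro hrej
      simp [σ, Function.update]

theorem wp_hypLoop {i j x' : ℕ} (hij : i ≤ j) (hK : K' ≤ N') (hk : k' ≤ N') (eN : s.reg .N = N')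
    (eK : s.reg .K = K') (ek : s.reg .k = k') (em : s.reg .mode = hypMode N' K' k')
    (ep : s.reg .pMode = hypProb N' K' k' (hypMode N' K' k')) (ed : s.drawn = 2 * i)
    (e0 : s.reg .done = 0)
    (hrej : ∀ l, i ≤ l → l < j → pairAt ω s.seed l ∈ hypReject N' K' k')
    (hacc : pairAt ω s.seed j ∈ hypAccept N' K' k' x') :
    Wp ω (.while (done ≺ 1) hypRound) s fun T s' => T ≤ 300 * (j - i + 2) ∧
      SameOff [.u, .v, .x, .done] s s' ∧ s'.reg .x = x' := by
  have hdone : (done ≺ 1).Holds s.reg := by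
    simp [holds_lt, eval_var, eval_zero, eval_one, eval_two, e0]
  have hcost : (done ≺ 1).cost = 3 := by decide
  induction hd : j - i generalizing i s with
  | zero =>
    obtain rfl : i = j := by omega
    refine wp_while_pos hdone ((wp_hypRound hK hk eN eK ek em ep ed).mono ?_)
    rintro T s' ⟨hT, hoff, -, -, hx, -⟩
    obtain ⟨h1, h2⟩ := hx x' hacc
    refine wp_while_neg ?_ ⟨?_, hoff, h2⟩
    · simp [holds_lt, eval_var, eval_zero, eval_one, eval_two, h1]
    · rw [hcost]; omega
  | succ d ih =>
    refine wp_while_pos hdone ((wp_hypRound hK hk eN eK ek em ep ed).mono ?_)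
    rintro T s' ⟨hT, hoff, hseed, hdr, -, hx⟩
    have h0 : s'.reg .done = 0 := by rw [hx (hrej i le_rfl (by omega)), e0]
    have hr : ∀ r, r ∉ [Var.u, .v, .x, .done] → s'.reg r = s.reg r := hoff
    refine (ih (i := i + 1) (s := s') (by omega) (by rw [hr _ (by decide), eN])
      (by rw [hr _ (by decide), eK]) (by rw [hr _ (by decide), ek]) (by rw [hr _ (by decide), em])
      (by rw [hr _ (by decide), ep]) hdr h0 ?_ (by rw [hseed]; exact hacc)
      (by simp [holds_lt, eval_var, eval_zero, eval_one, eval_two, h0]) (by omega)).mono ?_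
    · intro l hl hl'
      rw [hseed]
      exact hrej l (by omega) hl'
    · rintro T' s'' ⟨hT', hoff', hx'⟩
      refine ⟨by rw [hcost]; omega, fun r h => (hoff' r h).trans (hoff r h), hx'⟩

theorem wp_hypergeometric {j x' : ℕ} (hK : K' ≤ N') (hk : k' ≤ N') (eN : s.reg .N = N')
    (eK : s.reg .K = K') (ek : s.reg .k = k') (ed : s.drawn = 0)
    (hrej : ∀ l, l < j → pairAt ω s.seed l ∈ hypReject N' K' k')
    (hacc : pairAt ω s.seed j ∈ hypAccept N' K' k' x') :
    Wp ω hypergeometric s fun T s' => T ≤ 300 * j + 1000 ∧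
      SameOff [.u, .v, .x, .done, .mode, .pMode] s s' ∧ s'.reg .x = x' := by
  change Wp ω (.mode ::= .floor ((k + 1) * (K + 1) / (N + 2)) ;; .pMode ::= .exp (logHyp mode) ;;
    .done ::= 0 ;; .while (done ≺ 1) hypRound) s _
  simp only [wp_seq, wp_assign]
  have hm : (Expr.floor ((k + 1) * (K + 1) / (N + 2))).eval s.reg = hypMode N' K' k' := by
    simp only [eval_floor, eval_add, eval_mul, eval_div, eval_var, eval_zero, eval_one, eval_two, eN, eK, ek]
    rw [hypMode, ← Nat.floor_div_eq_div (K := ℝ), ← natCast_floor_eq_intCast_floor (by positivity)]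
    push_cast
    rfl
  rw [hm]
  have hp : (Expr.exp (logHyp mode)).eval (Function.update s.reg .mode (hypMode N' K' k' : ℝ)) =
      hypProb N' K' k' (hypMode N' K' k') := by
    rw [eval_exp]
    exact exp_eval_logHyp hK hk (le_hypMode hK hk) (hypMode_le_left hK) (hypMode_le_right hk)
      (by simp [Function.update, eN]) (by simp [Function.update, eK])
      (by simp [Function.update, ek]) (by simp [Function.update, eval_var])
  rw [hp]
  refine Wp.mono (wp_hypLoop (i := 0) (j := j) (x' := x') (Nat.zero_le j) hK hk
    (by simp [eN]) (by simp [eK]) (by simp [ek]) (by simp) (by simp) ed (by simp [eval_zero]) (fun l _ h => hrej l h) hacc) ?_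
  rintro T s' ⟨hT, hoff, hx⟩
  refine ⟨?_, fun r hr => ?_, hx⟩
  · have h1 : (Expr.floor ((k + 1) * (K + 1) / (N + 2))).cost = 12 := by decide
    have h2 : (Expr.exp (logHyp mode)).cost ≤ 100 := by decide
    have h3 : (0 : Expr).cost = 1 := rfl
    omega
  · simp at hr
    rw [hoff r (by simp [hr])]
    simp [Function.update, hr]

end Hypergeometric

end

noncomputable section

/-! ## Rows and cells -/

/-- The first row of the chunk `j`. -/
def rowOf (nV nP j : ℕ) : ℕ := j * nV / nP

/-- Number of off-diagonal entries in the chunks `a, …, b - 1`. -/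
def cellCount (nV nP a b : ℕ) : ℕ := (rowOf nV nP b - rowOf nV nP a) * (nV - 1)

theorem rowOf_mono {nV nP a b : ℕ} (h : a ≤ b) : rowOf nV nP a ≤ rowOf nV nP b :=
  Nat.div_le_div_right (Nat.mul_le_mul_right _ h)

theorem cellCount_add {nV nP a b c : ℕ} (hab : a ≤ b) (hbc : b ≤ c) :
    cellCount nV nP a b + cellCount nV nP b c = cellCount nV nP a c := by
  have h1 := rowOf_mono (nV := nV) (nP := nP) hab
  have h2 := rowOf_mono (nV := nV) (nP := nP) hbc
  unfold cellCount
  rw [← Nat.add_mul]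
  congr 1
  omega

theorem eval_firstRow {σ : Var → ℝ} {nV nP j : ℕ} {e : Expr} (en : σ .n = nV) (eP : σ .P = nP)
    (ej : e.eval σ = j) : (firstRow e).eval σ = rowOf nV nP j := by
  simp only [firstRow, eval_floor, eval_div, eval_mul, eval_var, en, eP, ej]
  rw [rowOf, ← Nat.floor_div_eq_div (K := ℝ), ← natCast_floor_eq_intCast_floor (by positivity)]
  push_cast
  rfl

theorem eval_cells {σ : Var → ℝ} {nV nP a b : ℕ} {e e' : Expr} (hn : 1 ≤ nV) (hab : a ≤ b)
    (en : σ .n = nV) (eP : σ .P = nP) (ea : e.eval σ = a) (eb : e'.eval σ = b) :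
    (cells e e').eval σ = cellCount nV nP a b := by
  simp only [cells, eval_mul, eval_sub, eval_firstRow en eP ea, eval_firstRow en eP eb, eval_var,
    eval_one, en]
  rw [cellCount, Nat.cast_mul, Nat.cast_sub (rowOf_mono hab), Nat.cast_sub hn, Nat.cast_one]

section

variable {ω : Source} {s : State}

/-! ## Writing vertices and edges -/

theorem wp_vertexLoop {nV nP h r : ℕ} (en : s.reg .n = nV) (eP : s.reg .P = nP)
    (eh : s.reg .hi = h) (er : s.reg .row = r) :
    Wp ω (.while (row ≺ firstRow hi) (.emitVertex row ;; .row ::= row + 1)) s fun T s' =>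
      T ≤ 50 * (rowOf nV nP h - r + 1) ∧ SameOff [.row] s s' := by
  have hiff : ∀ {s : State} {r : ℕ}, s.reg .n = nV → s.reg .P = nP → s.reg .hi = h →
      s.reg .row = r → ((row ≺ firstRow hi).Holds s.reg ↔ r < rowOf nV nP h) := by
    intro s r en eP eh er
    rw [holds_lt, eval_firstRow (e := hi) en eP eh, eval_var, er, Nat.cast_lt]
  have hcost : (row ≺ firstRow hi).cost = 8 := by decide
  induction hd : rowOf nV nP h - r generalizing s r with
  | zero =>
    refine wp_while_neg (by rw [hiff en eP eh er]; omega) ⟨by omega, fun r _ => rfl⟩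
  | succ d ih =>
    refine wp_while_pos ((hiff en eP eh er).2 (by omega)) ?_
    simp only [wp_seq, wp_assign, wp_emitVertex]
    refine Wp.mono (ih (r := r + 1) (by simp [en]) (by simp [eP]) (by simp [eh])
      (by simp [eval_add, eval_var, eval_one, er]) (by omega)) ?_
    rintro T s' ⟨hT, hoff⟩
    have h1 : (row + 1).cost = 3 := by decide
    have h2 : row.cost = 1 := rfl
    refine ⟨by omega, fun r hr => ?_⟩
    rw [hoff r hr]
    simp at hr
    simp [hr]

theorem wp_writeVertices {nV nP l h : ℕ} (en : s.reg .n = nV) (eP : s.reg .P = nP)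
    (el : s.reg .lo = l) (eh : s.reg .hi = h) :
    Wp ω writeVertices s fun T s' =>
      T ≤ 50 * (rowOf nV nP h - rowOf nV nP l) + 100 ∧ SameOff [.row] s s' := by
  simp only [writeVertices, wp_seq, wp_assign]
  refine Wp.mono (wp_vertexLoop (nV := nV) (nP := nP) (h := h) (r := rowOf nV nP l)
    (by simp [en]) (by simp [eP]) (by simp [eh]) (by simp [eval_firstRow (e := lo) en eP el])) ?_
  rintro T s' ⟨hT, hoff⟩
  have h1 : (firstRow lo).cost = 6 := by decide
  refine ⟨by omega, fun r hr => ?_⟩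
  rw [hoff r hr]
  simp at hr
  simp [hr]

theorem wp_writeEdge {e : Expr} (he : e.cost ≤ 3) :
    Wp ω (writeEdge e) s fun T s' => T ≤ 100 ∧ SameOff [.row, .col] s s' ∧ s'.seed = s.seed ∧
      s'.drawn = s.drawn := by
  have hc1 : (firstRow lo + .floor (e / (n - 1))).cost ≤ 20 := by
    change (firstRow lo).cost + (e.cost + (n - 1).cost + 1 + 1) + 1 ≤ 20
    have h1 : (firstRow lo).cost = 6 := by decide
    have h2 : (n - 1).cost = 3 := by decide
    omega
  have hc2 : (e - (n - 1) * .floor (e / (n - 1))).cost ≤ 20 := by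
    change e.cost + ((n - 1).cost + (e.cost + (n - 1).cost + 1 + 1) + 1) + 1 ≤ 20
    have h2 : (n - 1).cost = 3 := by decide
    omega
  have hc3 : (row ≼ col).cost = 3 := by decide
  have hc4 : (col + 1).cost = 3 := by decide
  have hc5 : row.cost = 1 := rfl
  have hc6 : col.cost = 1 := rfl
  simp only [writeEdge, wp_seq, wp_assign]
  by_cases hb : (row ≼ col).Holds (Function.update (Function.update s.reg .row
      ((firstRow lo + .floor (e / (n - 1))).eval s.reg)) .col
      ((e - (n - 1) * .floor (e / (n - 1))).eval (Function.update s.reg .row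
      ((firstRow lo + .floor (e / (n - 1))).eval s.reg))))
  · refine wp_ite_pos hb ?_
    simp only [wp_assign, wp_emitEdge]
    refine ⟨by omega, fun r hr => ?_, trivial, trivial⟩
    simp at hr
    simp [hr]
  · refine wp_ite_neg hb ?_
    simp only [wp_skip, wp_emitEdge]
    refine ⟨by omega, fun r hr => ?_, trivial, trivial⟩
    simp at hr
    simp [hr]

/-! ## Sampling by a scan -/

/-- The invariant k ≤ R survives: when k = R the test u R ≤ k always succeeds. Hence a scan ends
after at most R steps for every source. -/
theorem wp_scanStep {k' R' : ℕ} (ek : s.reg .k = k') (eR : s.reg .R = (R' + 1 : ℕ)) (hk : 1 ≤ k')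
    (hkR : k' ≤ R' + 1) :
    Wp ω scanStep s fun T s' => T ≤ 200 ∧
      ∃ k'' : ℕ, s'.reg .k = k'' ∧ s'.reg .R = R' ∧ k'' ≤ R' := by
  have hc1 : (u * R ≼ k).cost = 5 := by decide
  have hc2 : (t + 1).cost = 3 := by decide
  have hc3 : (R - 1).cost = 3 := by decide
  have hc4 : (k - 1).cost = 3 := by decide
  simp only [scanStep, wp_seq, wp_draw]
  by_cases hb : (u * R ≼ k).Holds (Function.update s.reg .u (ω (s.seed, s.drawn) : ℝ))
  · refine wp_ite_pos hb ?_
    simp only [wp_seq]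
    refine Wp.mono (wp_writeEdge (e := t) (by decide)) ?_
    rintro T s' ⟨hT, hoff, -, -⟩
    simp only [wp_assign]
    have h1 : s'.reg .k = k' := by rw [hoff _ (by decide)]; simp [ek]
    have h2 : s'.reg .R = (R' + 1 : ℕ) := by rw [hoff _ (by decide)]; simp [eR]
    refine ⟨by omega, k' - 1, ?_, ?_, by omega⟩
    · simp [eval_sub, eval_var, eval_one, h1, Nat.cast_sub hk]
    · simp [eval_sub, eval_var, eval_one, h2]
  · refine wp_ite_neg hb ?_
    simp only [wp_skip, wp_assign]
    refine ⟨by omega, k', ?_, ?_, ?_⟩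
    · simp [ek]
    · simp [eval_sub, eval_var, eval_one, eR]
    · by_contra hlt
      obtain rfl : k' = R' + 1 := by omega
      refine hb ?_
      have := unitInterval.le_one (ω (s.seed, s.drawn))
      have h0 : (0 : ℝ) ≤ (R' + 1 : ℕ) := by positivity
      simp only [holds_le, eval_mul, eval_var]
      simp only [Function.update_self, ne_eq, reduceCtorEq, not_false_eq_true,
        Function.update_of_ne, eR, ek]
      nlinarith

theorem wp_scanLoop {k' R' : ℕ} (ek : s.reg .k = k') (eR : s.reg .R = R') (hkR : k' ≤ R') :
    Wp ω (.while (1 ≼ k) scanStep) s fun T _ => T ≤ 300 * (R' + 1) := by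
  have hc : (1 ≼ k).cost = 3 := by decide
  induction R' generalizing s k' with
  | zero =>
    obtain rfl : k' = 0 := by omega
    exact wp_while_neg (by simp [holds_le, eval_var, eval_one, ek]) (by omega)
  | succ R' ih =>
    by_cases hk : 1 ≤ k'
    · refine wp_while_pos (by simpa [holds_le, eval_var, eval_one, ek] using hk) ?_
      refine Wp.mono (wp_scanStep ek eR hk hkR) ?_
      rintro T s' ⟨hT, k'', ek', eR', hk'⟩
      refine Wp.mono (ih ek' eR' hk') ?_
      intro T' s'' hT'
      omega
    · refine wp_while_neg ?_ (by omega)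
      obtain rfl : k' = 0 := by omega
      simp [holds_le, eval_var, eval_one, ek]

end

/-! ## Sampling by skips -/

/-- Union bound: a (q + 1)-subset either avoids x given elements or contains one of them, and each
element lies in `M.choose q` such subsets. -/
theorem choose_le_choose_sub_add (M x q : ℕ) :
    (M + 1).choose (q + 1) ≤ (M + 1 - x).choose (q + 1) + x * M.choose q := by
  induction x with
  | zero => simp
  | succ x ih =>
    refine ih.trans ?_
    rcases Nat.lt_or_ge M x with h | h
    · rw [show M + 1 - x = 0 by omega, show M + 1 - (x + 1) = 0 by omega]
      have : x * M.choose q ≤ (x + 1) * M.choose q := Nat.mul_le_mul_right _ (by omega)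
      omega
    · rw [show M + 1 - x = (M - x) + 1 by omega, show M + 1 - (x + 1) = M - x by omega,
        Nat.choose_succ_succ, Nat.succ_mul]
      have := Nat.choose_le_choose q (show M - x ≤ M by omega)
      rw [Nat.succ_eq_add_one]
      omega

/-- A random q-subset of M elements meets x given ones with probability at most q x / M, hence at
most 1/2. The hypothesis has the form 2 k x ≤ R for k = q + 1 and R = M + 1, as for a skip. -/
theorem choose_le_two_mul_choose_sub {M x q : ℕ} (h : 2 * (q + 1) * x ≤ M + 1) :
    M.choose q ≤ 2 * (M - x).choose q := by
  rcases q with _ | q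
  · simp
  rcases M with _ | M
  · simp
  rcases x with _ | x
  · simp; omega
  have h1 := choose_le_choose_sub_add M (x + 1) q
  have h2 := Nat.add_one_mul_choose_eq M q
  have h3 : 2 * ((x + 1) * M.choose q) ≤ (M + 1).choose (q + 1) := by
    refine Nat.le_of_mul_le_mul_left (c := M + 1) ?_ (by omega)
    calc (M + 1) * (2 * ((x + 1) * M.choose q)) = 2 * (x + 1) * ((M + 1) * M.choose q) := by ring
      _ = (2 * (x + 1) * (q + 1)) * (M + 1).choose (q + 1) := by rw [h2]; ring
      _ ≤ (M + 1) * (M + 1).choose (q + 1) := Nat.mul_le_mul_right _ (by nlinarith)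
  omega

/-- The acceptance test of a skip. -/
def skipTest : Test :=
  x ≼ R - k &
    v * (R / (R - k + 1)) * (k / R * .exp ((k - 1) * .log (1 - y / R))) ≼
      .exp (logChoose (R - x - 1) (k - 1) - logChoose R k)

/-- One round of acceptance-rejection for a skip. -/
def skipRound : Cmd :=
  .draw .u ;;
  .draw .v ;;
  .y ::= R * (1 - .exp (.log u / k)) ;;
  .x ::= .floor y ;;
  .ite skipTest (.done ::= 1) .skip

/-- The proposal of a skip. -/
def skipProposal (R' k' : ℕ) (a : ℝ) : ℝ := R' * (1 - Real.exp (Real.log a / k'))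

theorem skipProposal_nonneg {R' k' : ℕ} {a : ℝ} (h0 : 0 ≤ a) (h1 : a ≤ 1) :
    0 ≤ skipProposal R' k' a := by
  have : Real.exp (Real.log a / k') ≤ 1 :=
    Real.exp_le_one_iff.2 (div_nonpos_of_nonpos_of_nonneg (Real.log_nonpos h0 h1) (by positivity))
  exact mul_nonneg (by positivity) (by linarith)

/-- For u ≥ 2/3 the proposal is at most R/(2k): with δ = 1/(2k), if u^(1/k) < 1 - δ then u (1 + δ)^k
< 1, while Bernoulli's inequality gives (1 + δ)^k ≥ 3/2. -/
theorem skipProposal_le {R' k' : ℕ} {a : ℝ} (hk : 1 ≤ k') (h0 : 2 / 3 ≤ a) :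
    2 * k' * skipProposal R' k' a ≤ R' := by
  have hk0 : (0 : ℝ) < k' := by exact_mod_cast hk
  have hk1 : (1 : ℝ) ≤ k' := by exact_mod_cast hk
  set E := Real.exp (Real.log a / k') with hE
  have hE0 : 0 < E := Real.exp_pos _
  have hEk : E ^ k' = a := by
    rw [hE, ← Real.exp_nat_mul, mul_div_cancel₀ _ hk0.ne', Real.exp_log (by linarith)]
  have hE1 : 1 - 1 / (2 * k') ≤ E := by
    by_contra hlt
    push Not at hlt
    have b1 := one_add_mul_le_pow (a := 1 / (2 * (k' : ℝ)))
      (by have : 0 < 1 / (2 * (k' : ℝ)) := by positivity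
          linarith) k'
    have b2 : (k' : ℝ) * (1 / (2 * k')) = 1 / 2 := by field_simp
    rw [b2] at b1
    have b3 : E ^ k' * (1 + 1 / (2 * (k' : ℝ))) ^ k' < 1 := by
      rw [← mul_pow]
      refine pow_lt_one₀ (by positivity) ?_ (by omega)
      have : 0 < 1 / (2 * (k' : ℝ)) := by positivity
      nlinarith
    rw [hEk] at b3
    nlinarith
  have e : 2 * (k' : ℝ) * skipProposal R' k' a = R' * (2 * k' * (1 - E)) := by
    rw [skipProposal]; ring
  rw [e]
  refine mul_le_of_le_one_right (by positivity) ?_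
  have : 2 * (k' : ℝ) * (1 - E) ≤ 2 * k' * (1 / (2 * k')) := by gcongr; linarith
  refine this.trans (le_of_eq ?_)
  field_simp

section

variable {ω : Source} {s : State} {R' k' : ℕ}

/-- A skip of length at most R/(2k) has probability at least k/(2R), half of that of the skip 0. The
other side of the test is at most (2/5) k/(R - k + 1). The comparison needs only 5k ≤ R + 5, which
the threshold 13 gives with room to spare. -/
theorem skipTest_holds {σ : Var → ℝ} {a b : ℝ} (hk : 1 ≤ k') (hR : 13 * k' < R')
    (ha : 2 / 3 ≤ a) (ha1 : a ≤ 1) (hb : b ≤ 2 / 5) (eR : σ .R = R')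
    (ek : σ .k = k') (ev : σ .v = b) (ey : σ .y = skipProposal R' k' a)
    (ex : σ .x = ⌊skipProposal R' k' a⌋₊) : skipTest.Holds σ := by
  have hy0 := skipProposal_nonneg (R' := R') (k' := k') (by linarith) ha1
  have hy1 := skipProposal_le (R' := R') hk ha
  set z := ⌊skipProposal R' k' a⌋₊ with hz
  have hz1 : 2 * k' * z ≤ R' := by
    have h1 : (z : ℝ) ≤ skipProposal R' k' a := Nat.floor_le hy0
    have h2 : (2 * k' * z : ℝ) ≤ R' := le_trans (by gcongr) hy1
    exact_mod_cast h2
  have hz2 : 2 * z ≤ R' := le_trans (by nlinarith) hz1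
  have hzk : z + k' ≤ R' := by omega
  have hk0 : (0 : ℝ) < k' := by exact_mod_cast hk
  have hR0 : (0 : ℝ) < R' := by exact_mod_cast (show 0 < R' by omega)
  have hR13 : (13 : ℝ) * k' < R' := by exact_mod_cast hR
  refine ⟨?_, ?_⟩
  · simp only [holds_le, eval_sub, eval_var, ex, eR, ek]
    have : (z : ℝ) + k' ≤ R' := by exact_mod_cast hzk
    linarith
  · rw [holds_le, eval_exp, eval_sub,
      eval_logChoose (a := R - x - 1) (b := k - 1) (A := R' - 1 - z) (B := k' - 1)
        (by simp only [eval_sub, eval_var, eval_one, eR, ex]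
            rw [Nat.cast_sub (by omega), Nat.cast_sub (by omega)]; push_cast; ring)
        (by simp only [eval_sub, eval_var, eval_one, ek]
            rw [Nat.cast_sub hk]; push_cast; ring) (by omega),
      eval_logChoose (a := R) (b := k) (A := R') (B := k') eR ek (by omega), Real.exp_sub]
    have c1 : 0 < (R' - 1 - z).choose (k' - 1) := Nat.choose_pos (by omega)
    have c2 : 0 < R'.choose k' := Nat.choose_pos (by omega)
    rw [Real.exp_log (by exact_mod_cast c1), Real.exp_log (by exact_mod_cast c2)]
    simp only [eval_sub, eval_add, eval_mul, eval_div, eval_exp, eval_log, eval_var, eval_one, eR,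
      ek, ev, ey]
    have hE : 1 - skipProposal R' k' a / R' = Real.exp (Real.log a / k') := by
      rw [skipProposal]; field_simp; ring
    have hE1 : Real.exp (((k' : ℝ) - 1) * Real.log (1 - skipProposal R' k' a / R')) ≤ 1 := by
      rw [hE, Real.log_exp, Real.exp_le_one_iff]
      have : (1 : ℝ) ≤ k' := by exact_mod_cast hk
      exact mul_nonpos_of_nonneg_of_nonpos (by linarith)
        (div_nonpos_of_nonpos_of_nonneg (Real.log_nonpos (by linarith) ha1) hk0.le)
    have h1 : (R' - 1).choose (k' - 1) ≤ 2 * (R' - 1 - z).choose (k' - 1) :=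
      choose_le_two_mul_choose_sub (by
        rw [show k' - 1 + 1 = k' by omega, show R' - 1 + 1 = R' by omega]; exact hz1)
    have h2 : R' * (R' - 1).choose (k' - 1) = R'.choose k' * k' := by
      have := Nat.add_one_mul_choose_eq (R' - 1) (k' - 1)
      rwa [show k' - 1 + 1 = k' by omega, show R' - 1 + 1 = R' by omega] at this
    have h3 : (R'.choose k' : ℝ) * k' ≤ R' * (2 * (R' - 1 - z).choose (k' - 1)) := by
      rw [show (R'.choose k' : ℝ) * k' = (R' : ℝ) * (R' - 1).choose (k' - 1) by exact_mod_cast h2.symm]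
      exact mul_le_mul_of_nonneg_left (by exact_mod_cast h1) hR0.le
    have h4 : (0 : ℝ) < R' - k' + 1 := by linarith
    have c2' : (0 : ℝ) < R'.choose k' := by exact_mod_cast c2
    calc b * (R' / (R' - k' + 1)) * (k' / R' *
          Real.exp (((k' : ℝ) - 1) * Real.log (1 - skipProposal R' k' a / R')))
        ≤ 2 / 5 * (R' / (R' - k' + 1)) * (k' / R' * 1) := by gcongr
      _ = 2 * k' / (5 * (R' - k' + 1)) := by field_simp
      _ ≤ k' / (2 * R') := by
          rw [div_le_div_iff₀ (by positivity) (by positivity)]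
          nlinarith
      _ ≤ _ := by
          rw [div_le_div_iff₀ (by positivity) c2']
          linarith

/-- Only one implication is needed: a rejected pair is not in `skipAccept`. Other pairs may be
accepted as well, which only saves time. -/
theorem wp_skipRound {j : ℕ} (hk : 1 ≤ k') (hR : 13 * k' < R') (eR : s.reg .R = R')
    (ek : s.reg .k = k') (ed : s.drawn = 2 * j) (e0 : s.reg .done = 0) :
    Wp ω skipRound s fun T s' => T ≤ 200 ∧ SameOff [.u, .v, .y, .x, .done] s s' ∧
      s'.seed = s.seed ∧ s'.drawn = 2 * (j + 1) ∧
      ((s'.reg .done = 1 ∧ ∃ x' : ℕ, s'.reg .x = x' ∧ x' + k' ≤ R') ∨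
        (s'.reg .done = 0 ∧ pairAt ω s.seed j ∉ skipAccept)) := by
  simp only [skipRound, wp_seq, wp_draw, wp_assign]
  set z := pairAt ω s.seed j with hz
  have hz1 : (ω (s.seed, s.drawn) : ℝ) = z.1 := by rw [hz, pairAt, ed]
  have hz2 : (ω (s.seed, s.drawn + 1) : ℝ) = z.2 := by rw [hz, pairAt, ed]
  rw [hz1, hz2]
  have hy : (R * (1 - .exp (.log u / k))).eval
      (Function.update (Function.update s.reg .u (z.1 : ℝ)) .v (z.2 : ℝ)) =
      skipProposal R' k' z.1 := by
    simp [eval_mul, eval_sub, eval_exp, eval_div, eval_log, eval_var, eval_one, eR, ek,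
      skipProposal]
  rw [hy]
  have hy0 := skipProposal_nonneg (R' := R') (k' := k') z.1.2.1 z.1.2.2
  have hx : (Expr.floor y).eval (Function.update (Function.update (Function.update s.reg .u
      (z.1 : ℝ)) .v (z.2 : ℝ)) .y (skipProposal R' k' z.1)) = ⌊skipProposal R' k' z.1⌋₊ := by
    rw [eval_floor, eval_var, Function.update_self, natCast_floor_eq_intCast_floor hy0]
  rw [hx]
  set σ : Var → ℝ := Function.update (Function.update (Function.update (Function.update s.reg .u
      (z.1 : ℝ)) .v (z.2 : ℝ)) .y (skipProposal R' k' z.1)) .x (⌊skipProposal R' k' z.1⌋₊ : ℝ)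
    with hσ
  have eR' : σ .R = R' := by simp [σ, eR]
  have ek' : σ .k = k' := by simp [σ, ek]
  have ev' : σ .v = z.2 := by simp [σ]
  have ey' : σ .y = skipProposal R' k' z.1 := by simp [σ]
  have ex' : σ .x = ⌊skipProposal R' k' z.1⌋₊ := by simp [σ]
  have e0' : σ .done = 0 := by simp [σ, e0]
  have hoff : ∀ r, r ∉ [Var.u, .v, .y, .x, .done] → σ r = s.reg r := by
    intro r hr
    simp at hr
    simp [σ, hr]
  clear_value σ
  have hc1 : (R * (1 - .exp (.log u / k))).cost ≤ 20 := by decide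
  have hc2 : (Expr.floor y).cost = 2 := by decide
  have hc3 : skipTest.cost ≤ 100 := by decide
  have hc4 : (1 : Expr).cost = 1 := rfl
  by_cases h : skipTest.Holds σ
  · refine wp_ite_pos h (wp_assign.2 ⟨by omega, ?_, rfl, ?_, Or.inl ⟨?_, ⌊skipProposal R' k' z.1⌋₊,
      ?_, ?_⟩⟩)
    · intro r hr
      have := hoff r hr
      simp at hr
      simp [hr, this]
    · simp only [ed]; ring
    · simp [eval_one]
    · simp [ex']
    · have h1 := h.1
      simp only [holds_le, eval_sub, eval_var, eR', ek', ex'] at h1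
      have h2 : (⌊skipProposal R' k' z.1⌋₊ : ℝ) + k' ≤ R' := by linarith
      exact_mod_cast h2
  · refine wp_ite_neg h (wp_skip.2 ⟨by omega, hoff, rfl, ?_, Or.inr ⟨e0', fun hz' => h ?_⟩⟩)
    · simp only [ed]; ring
    · exact skipTest_holds hk hR hz'.1 z.1.2.2 hz'.2 eR' ek' ev' ey' ex'

open Classical in
theorem skipCount_eq {sd i j : ℕ} (h : i < j) : skipCount ω sd i j =
    (if pairAt ω sd i ∈ skipAccept then 1 else 0) + skipCount ω sd (i + 1) j := by
  unfold skipCount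
  rw [← Finset.insert_Ico_add_one_left_eq_Ico h, Finset.filter_insert]
  split_ifs
  · rw [Finset.card_insert_of_notMem (by simp), add_comm]
  · rw [zero_add]

theorem skipCount_self {sd i j : ℕ} (h : j ≤ i) : skipCount ω sd i j = 0 := by
  unfold skipCount
  rw [Finset.Ico_eq_empty (by omega)]
  simp

/-- All pairs read here except the last are rejected, so drawing one skip uses up at most one good
pair. One remaining good pair before j suffices for halting. -/
theorem wp_skipRounds {i j : ℕ} (hk : 1 ≤ k') (hR : 13 * k' < R') (eR : s.reg .R = R')
    (ek : s.reg .k = k') (ed : s.drawn = 2 * i) (e0 : s.reg .done = 0)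
    (hc : 1 ≤ skipCount ω s.seed i j) :
    Wp ω (.while (done ≺ 1) skipRound) s fun T s' => SameOff [.u, .v, .y, .x, .done] s s' ∧
      s'.seed = s.seed ∧ ∃ i', i < i' ∧ i' ≤ j ∧ s'.drawn = 2 * i' ∧ T ≤ 300 * (i' - i) + 100 ∧
        skipCount ω s.seed i j ≤ skipCount ω s.seed i' j + 1 ∧
        ∃ x' : ℕ, s'.reg .x = x' ∧ x' + k' ≤ R' := by
  have hcost : (done ≺ 1).cost = 3 := by decide
  induction hd : j - i generalizing i s with
  | zero => rw [skipCount_self (by omega)] at hc; omega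
  | succ d ih =>
    refine wp_while_pos (by simp [holds_lt, eval_var, eval_one, e0])
      (Wp.mono (wp_skipRound hk hR eR ek ed e0) ?_)
    rintro T s' ⟨hT, hoff, hseed, hdr, (⟨h1, hx⟩ | ⟨h0, hna⟩)⟩
    · refine wp_while_neg (by simp [holds_lt, eval_var, eval_one, h1])
        ⟨hoff, hseed, i + 1, by omega, by omega, hdr, by omega, ?_, hx⟩
      rw [skipCount_eq (by omega : i < j)]
      split_ifs <;> omega
    · have hc' : skipCount ω s.seed i j = skipCount ω s.seed (i + 1) j := by
        rw [skipCount_eq (by omega : i < j), if_neg hna, zero_add]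
      refine Wp.mono (ih (i := i + 1) (s := s') (by rw [hoff _ (by decide), eR])
        (by rw [hoff _ (by decide), ek]) hdr h0 (by rw [hseed, ← hc']; exact hc) (by omega)) ?_
      rintro T' s'' ⟨hoff', hseed', i', hi, hij, hdr', hT', hcount, hx⟩
      rw [hseed] at hcount
      exact ⟨fun r hr => (hoff' r hr).trans (hoff r hr), hseed'.trans hseed, i', by omega, hij,
        hdr', by omega, by omega, hx⟩

theorem wp_skipStep {i j : ℕ} (hk : 1 ≤ k') (hR : 13 * k' < R') (eR : s.reg .R = R')
    (ek : s.reg .k = k') (ed : s.drawn = 2 * i) (hc : 1 ≤ skipCount ω s.seed i j) :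
    Wp ω skipStep s fun T s' => s'.seed = s.seed ∧ ∃ i', i < i' ∧ i' ≤ j ∧ s'.drawn = 2 * i' ∧
      T ≤ 300 * (i' - i) + 500 ∧ skipCount ω s.seed i j ≤ skipCount ω s.seed i' j + 1 ∧
      ∃ R'' : ℕ, s'.reg .R = R'' ∧ s'.reg .k = (k' - 1 : ℕ) ∧ k' - 1 ≤ R'' := by
  change Wp ω (.done ::= 0 ;; .while (done ≺ 1) skipRound ;; writeEdge (t + x) ;;
    .t ::= t + x + 1 ;; .R ::= R - x - 1 ;; .k ::= k - 1) s _
  simp only [wp_seq, wp_assign]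
  refine Wp.mono (wp_skipRounds (i := i) (j := j) hk hR (by simp [eR]) (by simp [ek]) ed
    (by simp [eval_zero]) hc) ?_
  rintro T s' ⟨hoff, hseed, i', hi, hij, hdr, hT, hcount, x', hx, hxR⟩
  refine Wp.mono (wp_writeEdge (e := t + x) (by decide)) ?_
  rintro T' s'' ⟨hT', hoff', hseed', hdr'⟩
  have g1 : s''.reg .x = x' := by rw [hoff' _ (by decide), hx]
  have g2 : s''.reg .R = R' := by rw [hoff' _ (by decide), hoff _ (by decide)]; simp [eR]
  have g3 : s''.reg .k = k' := by rw [hoff' _ (by decide), hoff _ (by decide)]; simp [ek]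
  have hc1 : (t + x + 1).cost = 5 := by decide
  have hc2 : (R - x - 1).cost = 5 := by decide
  have hc3 : (k - 1).cost = 3 := by decide
  have hc4 : (0 : Expr).cost = 1 := rfl
  refine ⟨hseed'.trans hseed, i', hi, hij, hdr'.trans hdr, by omega, hcount, R' - x' - 1, ?_, ?_,
    by omega⟩
  · simp only [Function.update_of_ne, Function.update_self, ne_eq, reduceCtorEq,
      not_false_eq_true, eval_sub, eval_var, eval_one, g1, g2]
    rw [Nat.cast_sub (by omega), Nat.cast_sub (by omega), Nat.cast_one]
  · simp only [Function.update_of_ne, Function.update_self, ne_eq, reduceCtorEq,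
      not_false_eq_true, eval_sub, eval_var, eval_one, g3]
    rw [Nat.cast_sub hk, Nat.cast_one]

/-- Each skip reads at least one pair, so its fixed cost is charged to that pair and the time is
linear in j - i alone. The k good pairs assumed at the start are enough for k skips. -/
theorem wp_skipLoop {i j : ℕ} (hkR : k' ≤ R') (eR : s.reg .R = R') (ek : s.reg .k = k')
    (ed : s.drawn = 2 * i) (hc : k' ≤ skipCount ω s.seed i j) :
    Wp ω (.while (1 ≼ k & 13 * k ≺ R) skipStep) s fun T s' => T ≤ 1000 * (j - i) + 100 ∧
      ∃ R'' k'' : ℕ, s'.reg .R = R'' ∧ s'.reg .k = k'' ∧ k'' ≤ R'' ∧ k'' ≤ k' ∧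
        (k'' = 0 ∨ R'' ≤ 13 * k'') := by
  have hcost : (1 ≼ k & 13 * k ≺ R).cost = 9 := by decide
  have hiff : (1 ≼ k & 13 * k ≺ R).Holds s.reg ↔ 1 ≤ k' ∧ 13 * k' < R' := by
    simp only [holds_and, holds_le, holds_lt, eval_mul, eval_var, eval_one, eval_thirteen, ek, eR]
    norm_cast
  by_cases h : 1 ≤ k' ∧ 13 * k' < R'
  swap
  · exact wp_while_neg (mt hiff.1 h) ⟨by omega, R', k', eR, ek, hkR, le_rfl, by omega⟩
  induction k' generalizing s R' i with
  | zero => omega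
  | succ k' ih =>
    refine wp_while_pos (hiff.2 h) (Wp.mono (wp_skipStep (j := j) h.1 h.2 eR ek ed (by omega)) ?_)
    rintro T s' ⟨hseed, i', hi, hij, hdr, hT, hcount, R'', eR', ek', hle⟩
    rw [Nat.add_sub_cancel] at ek' hle
    have hiff' : (1 ≼ k & 13 * k ≺ R).Holds s'.reg ↔ 1 ≤ k' ∧ 13 * k' < R'' := by
      simp only [holds_and, holds_le, holds_lt, eval_mul, eval_var, eval_one, eval_thirteen, ek',
        eR']
      norm_cast
    by_cases h' : 1 ≤ k' ∧ 13 * k' < R''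
    · refine Wp.mono (ih hle eR' ek' hdr (by rw [hseed]; omega) hiff' h') ?_
      rintro T' s'' ⟨hT', R₃, k₃, h1, h2, h3, h4, h5⟩
      exact ⟨by omega, R₃, k₃, h1, h2, h3, by omega, h5⟩
    · exact wp_while_neg (mt hiff'.1 h') ⟨by omega, R'', k', eR', ek', hle, by omega, by omega⟩

/-- The scan starts with R ≤ 13k or does not run, which gives 3900 = 300 · 13. -/
theorem wp_sampleChunk {nV nP a b nd j : ℕ} (hn : 1 ≤ nV) (hab : a ≤ b) (en : s.reg .n = nV)
    (eP : s.reg .P = nP) (el : s.reg .lo = a) (eh : s.reg .hi = b) (end' : s.reg .node = nd)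
    (ek : s.reg .k = k') (hk : k' ≤ cellCount nV nP a b) (hc : k' ≤ skipCount ω nd 0 j) :
    Wp ω sampleChunk s fun T _ => T ≤ 1000 * j + 3900 * k' + 1000 := by
  simp only [sampleChunk, wp_seq, wp_seed, wp_assign]
  have hseed : ⌊node.eval s.reg⌋₊ = nd := by rw [eval_var, end', Nat.floor_natCast]
  rw [hseed]
  have hcells : (cells lo hi).eval (Function.update s.reg .t ((0 : Expr).eval s.reg)) =
      cellCount nV nP a b :=
    eval_cells hn hab (by simp [en]) (by simp [eP]) (by simp [eval_var, el])
      (by simp [eval_var, eh])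
  rw [hcells]
  refine Wp.mono (wp_skipLoop (i := 0) (j := j) hk (by simp) (by simp [ek]) rfl hc) ?_
  rintro T s' ⟨hT, R'', k'', eR'', ek'', h1, h2, h3⟩
  have hc1 : node.cost = 1 := rfl
  have hc2 : (0 : Expr).cost = 1 := rfl
  have hc3 : (cells lo hi).cost = 17 := by decide
  have hc4 : (1 ≼ k).cost = 3 := by decide
  rcases Nat.eq_zero_or_pos k'' with h0 | h0
  · refine wp_while_neg ?_ (by omega)
    simp [holds_le, eval_var, eval_one, ek'', h0]
  · refine Wp.mono (wp_scanLoop ek'' eR'' h1) ?_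
    intro T' s'' hT'
    omega

end

end

noncomputable section

/-! ## An exponential potential for the choice of the sample size -/

/-- The base of the potential in the number of rejected candidates. -/
def rejectBase : ℝ≥0∞ := ENNReal.ofReal (15 / 14)

/-- Exponential potential of the recursion of the PE `pe` on the chunks `lo, …, hi - 1` with the
sample size `κ`. If the recursion rejects `τ` candidates and ends with the sample size `κ'`, then
its value is at least `2 ^ κ' * rejectBase ^ τ`. -/
def potential (nV nP pe : ℕ) : ℕ → ℕ → ℕ → ℕ → ℕ → Source → ℝ≥0∞
  | 0, _, _, _, κ, _ => 2 ^ κ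
  | L + 1, a, b, nd, κ, ω =>
    if a + 1 < b then
      ∑' j, ∑ z ∈ Finset.range (κ + 1),
        firstAccept (cellCount nV nP a b) (cellCount nV nP a ((a + b + 1) / 2)) κ nd j z ω *
          (rejectBase ^ j *
            if pe < (a + b + 1) / 2 then
              potential nV nP pe L a ((a + b + 1) / 2) (2 * nd) z ω
            else potential nV nP pe L ((a + b + 1) / 2) b (2 * nd + 1) (κ - z) ω)
    else 2 ^ κ

variable {nV nP pe : ℕ}

theorem measurable_potential (L a b nd κ : ℕ) :
    Measurable (potential nV nP pe L a b nd κ) := by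
  induction L generalizing a b nd κ with
  | zero => exact measurable_const
  | succ L ih =>
    change Measurable fun ω => potential nV nP pe (L + 1) a b nd κ ω
    simp only [potential]
    split_ifs
    · exact Measurable.tsum fun j => Finset.measurable_fun_sum _ fun z _ =>
        (measurable_firstAccept _ _ _ _ _ _).mul ((ih _ _ _ _).const_mul _)
    · exact Measurable.tsum fun j => Finset.measurable_fun_sum _ fun z _ =>
        (measurable_firstAccept _ _ _ _ _ _).mul ((ih _ _ _ _).const_mul _)
    · exact measurable_const

theorem dependsOn_firstAccept (N K k s j x : ℕ) :
    DependsOn (firstAccept N K k s j x) {a : ℕ × ℕ | a.1 = s} := by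
  intro ω ω' h
  have hp : ∀ i, pairAt ω s i = pairAt ω' s i := fun i => by
    unfold pairAt
    rw [h (s, 2 * i) rfl, h (s, 2 * i + 1) rfl]
  unfold firstAccept
  simp only [hp]

/-- Heap numbers grow along the tree, strictly because nd ≥ 1. So the potentials of the children do
not involve the variates of the node itself. -/
theorem dependsOn_potential (L a b κ : ℕ) {nd : ℕ} (hnd : 1 ≤ nd) :
    DependsOn (potential nV nP pe L a b nd κ) {a : ℕ × ℕ | nd ≤ a.1} := by
  induction L generalizing a b nd κ with
  | zero => exact fun _ _ _ => rfl
  | succ L ih =>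
    intro ω ω' h
    unfold potential
    have h1 : ∀ j z N K, firstAccept N K κ nd j z ω = firstAccept N K κ nd j z ω' :=
      fun j z N K => dependsOn_firstAccept _ _ _ _ _ _ fun i hi => h i (le_of_eq hi.symm)
    have h2 : ∀ a b z, potential nV nP pe L a b (2 * nd) z ω =
        potential nV nP pe L a b (2 * nd) z ω' := fun a b z =>
      ih a b z (by omega) fun i hi => h i (by
        have : 2 * nd ≤ i.1 := hi
        change nd ≤ i.1; omega)
    have h3 : ∀ a b z, potential nV nP pe L a b (2 * nd + 1) z ω =
        potential nV nP pe L a b (2 * nd + 1) z ω' := fun a b z =>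
      ih a b z (by omega) fun i hi => h i (by
        have : 2 * nd + 1 ≤ i.1 := hi
        change nd ≤ i.1; omega)
    simp only [h1, h2, h3]

/-- The base 15/14 is chosen so that 7/8 · 15/14 = 15/16 is still below 1. -/
theorem lintegral_firstAccept_mul {N K k : ℕ} (hK : K ≤ N) (hk : k ≤ N) (s j : ℕ) {x : ℕ}
    (hx : x ≤ k) {g : Source → ℝ≥0∞} (hg : Measurable g) {s' : ℕ} (hs : s < s')
    (hgS : DependsOn g {a : ℕ × ℕ | s' ≤ a.1}) :
    ∫⁻ ω, firstAccept N K k s j x ω * (rejectBase ^ j * g ω) ∂sourceMeasure =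
      ENNReal.ofReal ((15 / 16) ^ j / 8) *
        (ENNReal.ofReal (hypProb N K k x) * ∫⁻ ω, g ω ∂sourceMeasure) := by
  rw [lintegral_mul_of_dependsOn (measurable_firstAccept _ _ _ _ _ _) (hg.const_mul _)
    (dependsOn_firstAccept _ _ _ _ _ _), lintegral_firstAccept s j hK hk hx,
    lintegral_const_mul _ hg, rejectBase, ← ENNReal.ofReal_pow (by norm_num), ← mul_assoc,
    ← mul_assoc, ← ENNReal.ofReal_mul
      (mul_nonneg (by positivity) (div_nonneg (hypProb_nonneg _ _ _ _) (by norm_num))),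
    ← ENNReal.ofReal_mul (by positivity)]
  · congr 2
    rw [show (15 / 16 : ℝ) = 7 / 8 * (15 / 14) by norm_num, mul_pow]
    ring
  · intro ω ω' h
    have : g ω = g ω' := hgS fun i hi => h i (by
      have : s' ≤ i.1 := hi
      change ¬ i.1 = s; omega)
    simp only [this]

/-- The binomial bound on the moment generating function of the sample size of `pe`. -/
def sizeBound (nV nP pe a b κ : ℕ) : ℝ :=
  (1 + (cellCount nV nP pe (pe + 1) : ℝ) / cellCount nV nP a b) ^ κ

theorem div_mul_div_cellCount {q K N : ℕ} (h : q ≤ K) :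
    (q : ℝ) / K * (K / N) = q / N := by
  rcases Nat.eq_zero_or_pos K with h0 | h0
  · obtain rfl : q = 0 := by omega
    simp
  · have : (K : ℝ) ≠ 0 := by positivity
    field_simp

theorem cellCount_le {a b c d : ℕ} (h1 : a ≤ c) (h2 : c ≤ d) (h3 : d ≤ b) :
    cellCount nV nP c d ≤ cellCount nV nP a b := by
  rw [← cellCount_add h1 (h2.trans h3), ← cellCount_add h2 h3]
  omega

theorem tsum_ofReal_geometric :
    ∑' j : ℕ, ENNReal.ofReal ((15 / 16) ^ j / 8) = 2 := by
  rw [← ENNReal.ofReal_tsum_of_nonneg (fun _ => by positivity)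
    ((summable_geometric_of_lt_one (by norm_num) (by norm_num)).div_const _), tsum_div_const,
    tsum_geometric_of_lt_one (by norm_num) (by norm_num)]
  norm_num

/-- At a leaf the interval is the chunk itself, so the base is 1 + 1. If the chunk has no cells, κ =
0. -/
theorem two_pow_le_sizeBound {a b κ : ℕ} (ha : a ≤ pe) (hb : pe < b) (h : b ≤ a + 1)
    (hκ : κ ≤ cellCount nV nP a b) :
    (2 : ℝ≥0∞) ^ κ ≤ ENNReal.ofReal (sizeBound nV nP pe a b κ) := by
  obtain rfl : pe = a := by omega
  obtain rfl : b = pe + 1 := by omega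
  rcases Nat.eq_zero_or_pos (cellCount nV nP pe (pe + 1)) with h0 | h0
  · obtain rfl : κ = 0 := by omega
    simp [sizeBound]
  · rw [sizeBound, div_self (by positivity), ENNReal.ofReal_pow (by norm_num)]
    norm_num

/-- Each level costs a factor 2 from the geometric series of rejections. Given the split, the
induction hypothesis is (1 + q/K)^z, and its hypergeometric mean is at most (1 + (q/K)(K/N))^κ = (1
+ q/N)^κ; the right half is symmetric. -/
theorem lintegral_potential_le (L : ℕ) {a b nd κ : ℕ} (hnd : 1 ≤ nd) (ha : a ≤ pe) (hb : pe < b)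
    (hab : b - a ≤ 2 ^ L) (hκ : κ ≤ cellCount nV nP a b) :
    ∫⁻ ω, potential nV nP pe L a b nd κ ω ∂sourceMeasure ≤
      2 ^ L * ENNReal.ofReal (sizeBound nV nP pe a b κ) := by
  induction L generalizing a b nd κ with
  | zero =>
    simp only [potential, lintegral_const, measure_univ, mul_one, pow_zero, one_mul]
    rw [pow_zero] at hab
    exact two_pow_le_sizeBound ha hb (by omega) hκ
  | succ L ih =>
    by_cases hlt : a + 1 < b
    swap
    · simp only [potential, if_neg hlt, lintegral_const, measure_univ, mul_one]
      refine (two_pow_le_sizeBound ha hb (by omega) hκ).trans ?_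
      exact le_mul_of_one_le_left zero_le (one_le_pow₀ (by norm_num))
    have hpow : 2 ^ (L + 1) = 2 * 2 ^ L := pow_succ' 2 L
    set c := (a + b + 1) / 2 with hc
    have hac : a < c := by omega
    have hcb : c < b := by omega
    have hN := cellCount_add (nV := nV) (nP := nP) hac.le hcb.le
    set N := cellCount nV nP a b with hNdef
    set K := cellCount nV nP a c with hKdef
    have hKN : K ≤ N := by omega
    set g : ℕ → Source → ℝ≥0∞ := fun z =>
      if pe < c then potential nV nP pe L a c (2 * nd) z
      else potential nV nP pe L c b (2 * nd + 1) (κ - z) with hg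
    have hgm : ∀ z, Measurable (g z) := by
      intro z
      rw [hg]
      simp only
      split_ifs <;> exact measurable_potential _ _ _ _ _
    have hgd : ∀ z, DependsOn (g z) {i : ℕ × ℕ | 2 * nd ≤ i.1} := by
      intro z
      rw [hg]
      simp only
      split_ifs
      · exact dependsOn_potential _ _ _ _ (by omega)
      · refine (dependsOn_potential _ _ _ _ (by omega)).mono fun i hi => ?_
        have : 2 * nd + 1 ≤ i.1 := hi
        change 2 * nd ≤ i.1; omega
    have hpot : ∀ ω, potential nV nP pe (L + 1) a b nd κ ω =
        ∑' j, ∑ z ∈ Finset.range (κ + 1),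
          firstAccept N K κ nd j z ω * (rejectBase ^ j * g z ω) := by
      intro ω
      rw [potential, if_pos hlt]
      refine tsum_congr fun j => Finset.sum_congr rfl fun z _ => ?_
      rw [hg]
      simp only
      split_ifs <;> rfl
    simp only [hpot]
    have hterm : ∀ j z, Measurable fun ω =>
        firstAccept N K κ nd j z ω * (rejectBase ^ j * g z ω) := fun j z =>
      (measurable_firstAccept _ _ _ _ _ _).mul ((hgm z).const_mul _)
    rw [lintegral_tsum fun j => (Finset.measurable_fun_sum _ fun z _ => hterm j z).aemeasurable]
    have hsum : ∑ z ∈ Finset.range (κ + 1),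
        ENNReal.ofReal (hypProb N K κ z) * ∫⁻ ω, g z ω ∂sourceMeasure ≤
        2 ^ L * ENNReal.ofReal (sizeBound nV nP pe a b κ) := by
      by_cases hpe : pe < c
      · have hq : cellCount nV nP pe (pe + 1) ≤ K := cellCount_le ha (by omega) (by omega)
        have hz : ∀ z ∈ Finset.range (κ + 1),
            ENNReal.ofReal (hypProb N K κ z) * ∫⁻ ω, g z ω ∂sourceMeasure ≤
            2 ^ L * ENNReal.ofReal (hypProb N K κ z *
              (1 + (cellCount nV nP pe (pe + 1) : ℝ) / K) ^ z) := by
          intro z hz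
          have hzκ : z ≤ κ := by simp at hz; omega
          -- The induction hypothesis needs a sample that fits into the half. Other z have
          -- probability 0.
          by_cases hs : κ + K ≤ N + z ∧ z ≤ K
          · have := ih (a := a) (b := c) (nd := 2 * nd) (κ := z) (by omega) ha hpe (by omega) hs.2
            rw [ENNReal.ofReal_mul (hypProb_nonneg _ _ _ _), mul_left_comm]
            gcongr
            rw [hg]
            simp only [if_pos hpe]
            exact this
          · rw [hypProb_eq_zero hKN hzκ hs]; simp
        refine (Finset.sum_le_sum hz).trans ?_
        rw [← Finset.mul_sum, ← ENNReal.ofReal_sum_of_nonneg fun z _ =>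
          mul_nonneg (hypProb_nonneg _ _ _ _) (by positivity)]
        gcongr
        refine (sum_hypProb_mul_pow_le hKN hκ (by positivity)).trans (le_of_eq ?_)
        rw [sizeBound, div_mul_div_cellCount hq]
      · have hpe' : c ≤ pe := by omega
        have hq : cellCount nV nP pe (pe + 1) ≤ cellCount nV nP c b :=
          cellCount_le hpe' (by omega) (by omega)
        have hcN : cellCount nV nP c b = N - K := by omega
        have hz : ∀ z ∈ Finset.range (κ + 1),
            ENNReal.ofReal (hypProb N K κ z) * ∫⁻ ω, g z ω ∂sourceMeasure ≤
            2 ^ L * ENNReal.ofReal (hypProb N K κ z *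
              (1 + (cellCount nV nP pe (pe + 1) : ℝ) / (N - K : ℕ)) ^ (κ - z)) := by
          intro z hz
          have hzκ : z ≤ κ := by simp at hz; omega
          by_cases hs : κ + K ≤ N + z ∧ z ≤ K
          · have := ih (a := c) (b := b) (nd := 2 * nd + 1) (κ := κ - z) (by omega) hpe' hb
              (by omega) (by omega)
            rw [ENNReal.ofReal_mul (hypProb_nonneg _ _ _ _), mul_left_comm]
            gcongr
            rw [hg, ← hcN]
            simp only [if_neg hpe]
            exact this
          · rw [hypProb_eq_zero hKN hzκ hs]; simp
        refine (Finset.sum_le_sum hz).trans ?_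
        rw [← Finset.mul_sum, ← ENNReal.ofReal_sum_of_nonneg fun z _ =>
          mul_nonneg (hypProb_nonneg _ _ _ _) (by positivity)]
        gcongr
        refine (sum_hypProb_mul_pow_sub_le hKN hκ (by positivity)).trans (le_of_eq ?_)
        rw [sizeBound, div_mul_div_cellCount (hcN ▸ hq)]
    have hj : ∀ j, ∫⁻ ω, ∑ z ∈ Finset.range (κ + 1),
        firstAccept N K κ nd j z ω * (rejectBase ^ j * g z ω) ∂sourceMeasure ≤
        ENNReal.ofReal ((15 / 16) ^ j / 8) *
          (2 ^ L * ENNReal.ofReal (sizeBound nV nP pe a b κ)) := by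
      intro j
      rw [lintegral_finsetSum _ fun z _ => hterm j z,
        Finset.sum_congr rfl fun z hz => lintegral_firstAccept_mul hKN hκ nd j
          (by simp at hz; omega) (hgm z) (by omega : nd < 2 * nd) (hgd z), ← Finset.mul_sum]
      gcongr
    refine (ENNReal.tsum_le_tsum hj).trans (le_of_eq ?_)
    rw [ENNReal.tsum_mul_right, tsum_ofReal_geometric, ← mul_assoc, pow_succ']

theorem le_potential {ω : Source} {L a b nd κ j z : ℕ} (hlt : a + 1 < b) (hz : z ≤ κ)
    (hrej : ∀ l < j, pairAt ω nd l ∈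
      hypReject (cellCount nV nP a b) (cellCount nV nP a ((a + b + 1) / 2)) κ)
    (hacc : pairAt ω nd j ∈
      hypAccept (cellCount nV nP a b) (cellCount nV nP a ((a + b + 1) / 2)) κ z) :
    (rejectBase ^ j * if pe < (a + b + 1) / 2 then
        potential nV nP pe L a ((a + b + 1) / 2) (2 * nd) z ω
      else potential nV nP pe L ((a + b + 1) / 2) b (2 * nd + 1) (κ - z) ω) ≤
      potential nV nP pe (L + 1) a b nd κ ω := by
  rw [potential, if_pos hlt]
  refine le_trans ?_ (ENNReal.le_tsum j)
  refine le_trans ?_ (Finset.single_le_sum (fun _ _ => zero_le)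
    (Finset.mem_range.2 (Nat.lt_succ_of_le hz)))
  have h1 : firstAccept (cellCount nV nP a b) (cellCount nV nP a ((a + b + 1) / 2)) κ nd j z ω
      = 1 := by
    unfold firstAccept
    rw [Finset.prod_eq_one fun i hi => by simp [hrej i (Finset.mem_range.1 hi)]]
    simp [hacc]
  rw [h1, one_mul]

/-! ## Running time of the choice of the sample size -/

/-- One level of the recursion. -/
def chooseRound : Cmd :=
  .mid ::= .floor ((lo + hi + 1) / 2) ;;
  .N ::= cells lo hi ;;
  .K ::= cells lo mid ;;
  .seed node ;;
  hypergeometric ;;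
  .ite (i ≺ mid)
    (.hi ::= mid ;; .k ::= x ;; .node ::= 2 * node)
    (.lo ::= mid ;; .k ::= k - x ;; .node ::= 2 * node + 1)

/-- The registers of the PE `pe` when it has reached the node `nd` with the chunks `a, …, b - 1` and
the sample size `κ`. -/
structure AtNode (nV nP pe a b nd κ : ℕ) (s : State) : Prop where
  n_eq : s.reg .n = nV
  P_eq : s.reg .P = nP
  i_eq : s.reg .i = pe
  lo_eq : s.reg .lo = a
  hi_eq : s.reg .hi = b
  node_eq : s.reg .node = nd
  k_eq : s.reg .k = κ

theorem wp_chooseRound {ω : Source} {s : State} {a b nd κ j z : ℕ} (hn : 1 ≤ nV)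
    (hs : AtNode nV nP pe a b nd κ s) (hlt : a + 1 < b) (hκ : κ ≤ cellCount nV nP a b)
    (hrej : ∀ l < j, pairAt ω nd l ∈
      hypReject (cellCount nV nP a b) (cellCount nV nP a ((a + b + 1) / 2)) κ)
    (hacc : pairAt ω nd j ∈
      hypAccept (cellCount nV nP a b) (cellCount nV nP a ((a + b + 1) / 2)) κ z) :
    Wp ω chooseRound s fun T s' => T ≤ 300 * j + 1200 ∧
      if pe < (a + b + 1) / 2 then AtNode nV nP pe a ((a + b + 1) / 2) (2 * nd) z s'
      else AtNode nV nP pe ((a + b + 1) / 2) b (2 * nd + 1) (κ - z) s' := by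
  obtain ⟨en, eP, ei, el, eh, end', ek⟩ := hs
  have hmid : (Expr.floor ((lo + hi + 1) / 2)).eval s.reg = ((a + b + 1) / 2 : ℕ) := by
    simp only [eval_floor, eval_div, eval_add, eval_var, eval_one, eval_two, el, eh]
    rw [← Nat.floor_div_eq_div (K := ℝ), ← natCast_floor_eq_intCast_floor (by positivity)]
    push_cast
    rfl
  set c := (a + b + 1) / 2 with hc
  have hac : a ≤ c := by omega
  have hcb : c ≤ b := by omega
  simp only [chooseRound, wp_seq, wp_assign, wp_seed]
  rw [hmid]
  have hN : (cells lo hi).eval (Function.update s.reg .mid (c : ℝ)) = cellCount nV nP a b :=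
    eval_cells hn (hac.trans hcb) (by simp [en]) (by simp [eP]) (by simp [eval_var, el])
      (by simp [eval_var, eh])
  rw [hN]
  have hK : (cells lo mid).eval (Function.update (Function.update s.reg .mid (c : ℝ)) .N
      (cellCount nV nP a b : ℝ)) = cellCount nV nP a c :=
    eval_cells hn hac (by simp [en]) (by simp [eP]) (by simp [eval_var, el]) (by simp [eval_var])
  rw [hK]
  set σ : Var → ℝ := Function.update (Function.update (Function.update s.reg .mid (c : ℝ)) .N
      (cellCount nV nP a b : ℝ)) .K (cellCount nV nP a c : ℝ) with hσ
  have hseed : ⌊node.eval σ⌋₊ = nd := by simp [σ, eval_var, end']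
  rw [hseed]
  refine Wp.mono (wp_hypergeometric (j := j) (x' := z) (cellCount_le le_rfl hac hcb) hκ
    (by simp [σ]) (by simp [σ]) (by simp [σ, ek]) rfl hrej hacc) ?_
  rintro T s' ⟨hT, hoff, hx⟩
  have g1 : s'.reg .n = nV := by rw [hoff _ (by decide)]; simp [σ, en]
  have g2 : s'.reg .P = nP := by rw [hoff _ (by decide)]; simp [σ, eP]
  have g3 : s'.reg .i = pe := by rw [hoff _ (by decide)]; simp [σ, ei]
  have g4 : s'.reg .lo = a := by rw [hoff _ (by decide)]; simp [σ, el]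
  have g5 : s'.reg .hi = b := by rw [hoff _ (by decide)]; simp [σ, eh]
  have g6 : s'.reg .node = nd := by rw [hoff _ (by decide)]; simp [σ, end']
  have g7 : s'.reg .k = κ := by rw [hoff _ (by decide)]; simp [σ, ek]
  have g8 : s'.reg .mid = c := by rw [hoff _ (by decide)]; simp [σ]
  have hc1 : (Expr.floor ((lo + hi + 1) / 2)).cost ≤ 20 := by decide
  have hc2 : (cells lo hi).cost = 17 := by decide
  have hc3 : (cells lo mid).cost = 17 := by decide
  have hc4 : (i ≺ mid).cost = 3 := by decide
  have hc5 : mid.cost = 1 := rfl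
  have hc6 : x.cost = 1 := rfl
  have hc7 : (2 * node).cost = 3 := by decide
  have hc8 : (2 * node + 1).cost = 5 := by decide
  have hc9 : (k - x).cost = 3 := by decide
  have hc10 : node.cost = 1 := rfl
  have hzκ : z ≤ κ := hacc.2.2.1
  by_cases hpe : pe < c
  · refine wp_ite_pos (by simpa [holds_lt, eval_var, g3, g8] using hpe) ?_
    simp only [wp_seq, wp_assign, if_pos hpe]
    refine ⟨by omega, ⟨by simp [g1], by simp [g2], by simp [g3], by simp [g4],
      by simp [eval_var, g8], by simp [eval_mul, eval_two, eval_var, g6],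
      by simp [eval_var, hx]⟩⟩
  · refine wp_ite_neg (by simpa [holds_lt, eval_var, g3, g8] using hpe) ?_
    simp only [wp_seq, wp_assign, if_neg hpe]
    refine ⟨by omega, ⟨by simp [g1], by simp [g2], by simp [g3], by simp [eval_var, g8],
      by simp [g5], by simp [eval_add, eval_mul, eval_one, eval_two, eval_var, g6],
      by simp [eval_sub, eval_var, hx, g7, Nat.cast_sub hzκ]⟩⟩

theorem holds_chooseTest_iff {s : State} {a b nd κ : ℕ} (hs : AtNode nV nP pe a b nd κ s) :
    (lo + 1 ≺ hi).Holds s.reg ↔ a + 1 < b := by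
  simp only [holds_lt, eval_add, eval_var, eval_one, hs.lo_eq, hs.hi_eq]
  norm_cast

/-- For a fixed source, following the branch of first acceptances bounds the potential from below by
its actual value. The bound on nd' holds since a path of at most L steps from nd stays below (nd +
1) 2^L; from the root this leaves fewer than 2 · 2^L seeds for the union bound. -/
theorem wp_chooseLoop {ω : Source}
    (hω : ∀ N K k s : ℕ, K ≤ N → k ≤ N → ∃ j, pairAt ω s j ∉ hypReject N K k) (hn : 1 ≤ nV)
    (L : ℕ) {s : State} {a b nd κ : ℕ} (hs : AtNode nV nP pe a b nd κ s) (ha : a ≤ pe) (hb : pe < b)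
    (hab : b - a ≤ 2 ^ L) (hκ : κ ≤ cellCount nV nP a b) :
    Wp ω (.while (lo + 1 ≺ hi) chooseRound) s fun T s' => ∃ nd' κ' τ,
      AtNode nV nP pe pe (pe + 1) nd' κ' s' ∧ κ' ≤ cellCount nV nP pe (pe + 1) ∧
      nd' < (nd + 1) * 2 ^ L ∧ T ≤ 300 * τ + 1300 * L + 10 ∧
      2 ^ κ' * rejectBase ^ τ ≤ potential nV nP pe L a b nd κ ω := by
  have hcost : (lo + 1 ≺ hi).cost = 5 := by decide
  have leaf : ∀ {L a b nd κ : ℕ} {s : State}, AtNode nV nP pe a b nd κ s → a ≤ pe → pe < b →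
      κ ≤ cellCount nV nP a b → ¬ a + 1 < b →
      Wp ω (.while (lo + 1 ≺ hi) chooseRound) s fun T s' => ∃ nd' κ' τ,
        AtNode nV nP pe pe (pe + 1) nd' κ' s' ∧ κ' ≤ cellCount nV nP pe (pe + 1) ∧
        nd' < (nd + 1) * 2 ^ L ∧ T ≤ 300 * τ + 1300 * L + 10 ∧
        2 ^ κ' * rejectBase ^ τ ≤ potential nV nP pe L a b nd κ ω := by
    intro L a b nd κ s hs ha hb hκ hlt
    obtain rfl : a = pe := by omega
    obtain rfl : b = a + 1 := by omega
    refine wp_while_neg (mt (holds_chooseTest_iff hs).1 hlt) ⟨nd, κ, 0, hs, hκ, ?_, by omega, ?_⟩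
    · nlinarith [Nat.one_le_two_pow (n := L)]
    · rcases L with _ | L <;> simp [potential]
  induction L generalizing s a b nd κ with
  | zero => exact leaf hs ha hb hκ (by rw [pow_zero] at hab; omega)
  | succ L ih =>
    by_cases hlt : a + 1 < b
    swap
    · exact leaf hs ha hb hκ hlt
    have hpow : 2 ^ (L + 1) = 2 * 2 ^ L := pow_succ' 2 L
    set c := (a + b + 1) / 2 with hc
    have hac : a ≤ c := by omega
    have hcb : c ≤ b := by omega
    have hN := cellCount_add (nV := nV) (nP := nP) hac hcb
    classical
    have hex := hω (cellCount nV nP a b) (cellCount nV nP a c) κ nd (by omega) hκ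
    set j := Nat.find hex with hj
    have hacc' : ∃ z, pairAt ω nd j ∈ hypAccept (cellCount nV nP a b) (cellCount nV nP a c) κ z := by
      by_contra hcon
      push Not at hcon
      exact Nat.find_spec hex hcon
    obtain ⟨z, hacc⟩ := hacc'
    have hrej : ∀ l < j, pairAt ω nd l ∈
        hypReject (cellCount nV nP a b) (cellCount nV nP a c) κ := fun l hl =>
      not_not.1 (Nat.find_min hex hl)
    clear_value j
    have hz1 := hacc.2.1
    have hz2 := hacc.2.2.1
    have hz3 := hacc.2.2.2.1
    have hpot := le_potential (pe := pe) (L := L) hlt hz2 hrej hacc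
    refine wp_while_pos ((holds_chooseTest_iff hs).2 hlt) (Wp.mono (wp_chooseRound hn hs hlt hκ hrej hacc) ?_)
    rintro T s' ⟨hT, hs'⟩
    rw [← hc] at hs' hpot
    by_cases hpe : pe < c
    · rw [if_pos hpe] at hs' hpot
      refine Wp.mono (ih hs' ha hpe (by omega) hz3) ?_
      rintro T' s'' ⟨nd', κ', τ, h1, h2, h3, h4, h5⟩
      refine ⟨nd', κ', j + τ, h1, h2, ?_, by omega, ?_⟩
      · rw [hpow]
        nlinarith [Nat.one_le_two_pow (n := L)]
      · refine le_trans (le_of_eq ?_) ((mul_le_mul_right h5 (rejectBase ^ j)).trans hpot)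
        rw [pow_add]; ring
    · rw [if_neg hpe] at hs' hpot
      refine Wp.mono (ih hs' (by omega) hb (by omega) (by omega)) ?_
      rintro T' s'' ⟨nd', κ', τ, h1, h2, h3, h4, h5⟩
      refine ⟨nd', κ', j + τ, h1, h2, ?_, by omega, ?_⟩
      · rw [hpow]
        nlinarith [Nat.one_le_two_pow (n := L)]
      · refine le_trans (le_of_eq ?_) ((mul_le_mul_right h5 (rejectBase ^ j)).trans hpot)
        rw [pow_add]; ring

end

section

/-! ## Running time of one PE -/

theorem rowOf_self {nV nP : ℕ} (hP : 1 ≤ nP) : rowOf nV nP nP = nV :=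
  Nat.mul_div_cancel_left nV (by omega)

theorem cellCount_all {nV nP : ℕ} (hP : 1 ≤ nP) : cellCount nV nP 0 nP = nV * (nV - 1) := by
  rw [cellCount, rowOf_self hP, rowOf]; simp

theorem rowOf_succ_sub_mul_le {nV nP j : ℕ} (hP : 1 ≤ nP) :
    (rowOf nV nP (j + 1) - rowOf nV nP j) * nP ≤ nV + nP := by
  have h1 := Nat.div_mul_le_self ((j + 1) * nV) nP
  have h2 := Nat.lt_div_mul_add (a := j * nV) (b := nP) (by omega)
  rw [Nat.sub_mul]
  unfold rowOf
  rw [Nat.add_mul, one_mul] at h1 ⊢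
  omega

/-- For a source on which the potential of the recursion and the numbers of accepted skips are
controlled, the PE `pe` halts in time. -/
theorem peTime_le {ω : Source}
    (hω : ∀ N K k s : ℕ, K ≤ N → k ≤ N → ∃ j, pairAt ω s j ∉ hypReject N K k)
    {nV nE nP pe L B : ℕ} (hn : 1 ≤ nV) (hP : 1 ≤ nP) (hE : nE ≤ nV * (nV - 1)) (hpe : pe < nP)
    (hL : nP ≤ 2 ^ L) (hB : ∀ sd < 2 * 2 ^ L, B ≤ skipCount ω sd 0 (30 * B)) :
    ∃ κ τ : ℕ, 2 ^ κ * rejectBase ^ τ ≤ potential nV nP pe L 0 nP 1 nE ω ∧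
      (κ ≤ B → peTime ω nV nE nP pe ≤
        ((300 * τ + 1300 * L + 50 * (rowOf nV nP (pe + 1) - rowOf nV nP pe) + 33900 * B + 2000 : ℕ) :
          ℕ∞)) := by
  have h : Wp ω chooseSampleSize (init nV nE nP pe) fun T s' => ∃ nd' κ' τ,
      AtNode nV nP pe pe (pe + 1) nd' κ' s' ∧ κ' ≤ cellCount nV nP pe (pe + 1) ∧
      nd' < 2 * 2 ^ L ∧ T ≤ 300 * τ + 1300 * L + 30 ∧
      2 ^ κ' * rejectBase ^ τ ≤ potential nV nP pe L 0 nP 1 nE ω := by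
    change Wp ω (.lo ::= 0 ;; .hi ::= P ;; .node ::= 1 ;; .k ::= m ;;
      .while (lo + 1 ≺ hi) chooseRound) _ _
    simp only [wp_seq, wp_assign]
    refine Wp.mono (wp_chooseLoop (nV := nV) (nP := nP) (pe := pe) (a := 0) (b := nP) (nd := 1)
      (κ := nE) hω hn L ?_ (Nat.zero_le _) hpe (by simpa using hL)
      (by rw [cellCount_all hP]; exact hE)) ?_
    · exact ⟨by simp [init], by simp [init], by simp [init], by simp [eval_zero],
        by simp [init, eval_var], by simp [eval_one], by simp [init, eval_var]⟩
    · rintro T s' ⟨nd', κ', τ, h1, h2, h3, h4, h5⟩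
      have c1 : (0 : Expr).cost = 1 := rfl
      have c2 : (1 : Expr).cost = 1 := rfl
      have c3 : P.cost = 1 := rfl
      have c4 : m.cost = 1 := rfl
      exact ⟨nd', κ', τ, h1, h2, h3, by omega, h5⟩
  obtain ⟨T₁, s₁, hx₁, nd, κ, τ, hs, hκ, hnd, hT₁, hpot⟩ := h
  refine ⟨κ, τ, hpot, fun hκB => ?_⟩
  obtain ⟨T₂, s₂, hx₂, hT₂, hoff⟩ := wp_writeVertices (ω := ω) hs.n_eq hs.P_eq hs.lo_eq hs.hi_eq
  -- The leaf seed depends on the PE, but `hB` covers every seed of the tree. With κ ≤ B the cost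
  -- 1000 · 30B + 3900κ gives the term 33900B.
  obtain ⟨T₃, s₃, hx₃, hT₃⟩ := wp_sampleChunk (ω := ω) (s := s₂) (j := 30 * B) hn (Nat.le_succ pe)
    (by rw [hoff _ (by decide), hs.n_eq]) (by rw [hoff _ (by decide), hs.P_eq])
    (by rw [hoff _ (by decide), hs.lo_eq]) (by rw [hoff _ (by decide), hs.hi_eq])
    (by rw [hoff _ (by decide), hs.node_eq]) (by rw [hoff _ (by decide), hs.k_eq]) hκ
    (hκB.trans (hB nd hnd))
  have hx : Exec ω generator (init nV nE nP pe) (T₁ + (T₂ + T₃)) s₃ :=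
    .seq hx₁ (.seq hx₂ hx₃)
  refine (iInf₂_le (T₁ + (T₂ + T₃)) ⟨s₃, hx⟩).trans ?_
  rw [Nat.cast_le]
  omega

/-! ## High probability bounds -/

/-- A chunk has at most n/P + 1 rows, a fraction at most (1 + P/n)/P ≤ (1 + A)/P of all rows. Here
the assumption P ≤ A n enters. -/
theorem sizeBound_le {nV nE nP pe : ℕ} {A : ℝ} (hP : 1 ≤ nP) (hn : 1 ≤ nV) (hA : 0 ≤ A)
    (hPA : (nP : ℝ) ≤ A * nV) :
    sizeBound nV nP pe 0 nP nE ≤ Real.exp ((1 + A) * (nE / nP)) := by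
  have hP0 : (0 : ℝ) < nP := by exact_mod_cast hP
  have hn0 : (0 : ℝ) < nV := by exact_mod_cast hn
  have hq : (cellCount nV nP pe (pe + 1) : ℝ) / cellCount nV nP 0 nP ≤ (1 + A) / nP := by
    have hrows : ((rowOf nV nP (pe + 1) - rowOf nV nP pe : ℕ) : ℝ) * nP ≤ nV + nP := by
      exact_mod_cast rowOf_succ_sub_mul_le hP
    rw [cellCount_all hP, cellCount, Nat.cast_mul, Nat.cast_mul]
    rcases Nat.eq_zero_or_pos (nV - 1) with h | h
    · rw [h]; simp; positivity
    · rw [mul_div_mul_right _ _ (by positivity), div_le_div_iff₀ hn0 hP0]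
      linarith
  unfold sizeBound
  calc _ ≤ Real.exp ((1 + A) / nP) ^ nE := by
        gcongr
        have := Real.add_one_le_exp ((1 + A) / nP)
        linarith
    _ = _ := by rw [← Real.exp_nat_mul]; congr 1; ring

theorem measure_potential_gt_le {nV nE nP pe L : ℕ} {A Q : ℝ} (hP : 1 ≤ nP) (hn : 1 ≤ nV)
    (hA : 0 ≤ A) (hPA : (nP : ℝ) ≤ A * nV) (hE : nE ≤ nV * (nV - 1)) (hpe : pe < nP)
    (hL : nP ≤ 2 ^ L) :
    sourceMeasure {ω | ENNReal.ofReal (Real.exp Q) ≤ potential nV nP pe L 0 nP 1 nE ω} ≤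
      ENNReal.ofReal (2 ^ L * Real.exp ((1 + A) * (nE / nP) - Q)) := by
  have h1 := meas_ge_le_lintegral_div (μ := sourceMeasure)
    (measurable_potential (nV := nV) (nP := nP) (pe := pe) L 0 nP 1 nE).aemeasurable
    (ε := ENNReal.ofReal (Real.exp Q)) (by simp [Real.exp_pos]) (by simp)
  refine h1.trans ?_
  have h2 := lintegral_potential_le (nV := nV) (nP := nP) (pe := pe) L (a := 0) (b := nP) (nd := 1)
    (κ := nE) le_rfl (Nat.zero_le _) hpe (by simpa using hL) (by rw [cellCount_all hP]; exact hE)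
  calc _ ≤ 2 ^ L * ENNReal.ofReal (Real.exp ((1 + A) * (nE / nP))) /
        ENNReal.ofReal (Real.exp Q) := by
        refine ENNReal.div_le_div_right (h2.trans ?_) _
        gcongr
        exact sizeBound_le hP hn hA hPA
    _ = _ := by
        have e : (2 : ℝ≥0∞) ^ L = ENNReal.ofReal (2 ^ L) := by
          rw [ENNReal.ofReal_pow (by norm_num)]; norm_num
        rw [e, ← ENNReal.ofReal_mul (by positivity), ← ENNReal.ofReal_div_of_pos (Real.exp_pos _),
          mul_div_assoc, ← Real.exp_sub]

theorem le_of_pow_mul_rejectBase_pow_le {κ τ : ℕ} {Q : ℝ}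
    (h : 2 ^ κ * rejectBase ^ τ ≤ ENNReal.ofReal (Real.exp Q)) : κ ≤ 2 * Q ∧ τ ≤ 15 * Q := by
  have e : (2 : ℝ≥0∞) ^ κ * rejectBase ^ τ = ENNReal.ofReal (2 ^ κ * (15 / 14) ^ τ) := by
    rw [rejectBase, ENNReal.ofReal_mul (by positivity), ENNReal.ofReal_pow (by norm_num),
      ENNReal.ofReal_pow (by norm_num)]
    norm_num
  rw [e, ENNReal.ofReal_le_ofReal_iff (Real.exp_pos _).le] at h
  have h1 := Real.log_le_log (by positivity) h
  rw [Real.log_exp, Real.log_mul (by positivity) (by positivity), Real.log_pow, Real.log_pow] at h1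
  have l2 : (1 / 2 : ℝ) ≤ Real.log 2 := by have := Real.log_two_gt_d9; linarith
  have l3 : (1 / 15 : ℝ) ≤ Real.log (15 / 14) := by
    have := Real.one_sub_inv_le_log_of_pos (show (0 : ℝ) < 15 / 14 by norm_num)
    norm_num at this
    linarith
  have k0 : (0 : ℝ) ≤ κ := by positivity
  have t0 : (0 : ℝ) ≤ τ := by positivity
  have a1 : (κ : ℝ) * (1 / 2) ≤ κ * Real.log 2 := by gcongr
  have a2 : (τ : ℝ) * (1 / 15) ≤ τ * Real.log (15 / 14) := by gcongr
  constructor <;> nlinarith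

theorem exists_log_two_bound {nP : ℕ} (hP : 2 ≤ nP) :
    ∃ L : ℕ, nP ≤ 2 ^ L ∧ 2 ^ L ≤ 2 * nP ∧ (L : ℝ) ≤ 4 * Real.log nP := by
  refine ⟨Nat.clog 2 nP, Nat.le_pow_clog (by norm_num) _, ?_, ?_⟩
  all_goals
    have h1 : 2 ^ Nat.clog 2 nP ≤ 2 * nP := by
      have h2 := Nat.pow_pred_clog_lt_self (b := 2) (by norm_num) (x := nP) (by omega)
      have h3 : 0 < Nat.clog 2 nP := Nat.clog_pos (by norm_num) hP
      obtain ⟨l, hl⟩ := Nat.exists_eq_succ_of_ne_zero h3.ne'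
      rw [hl] at h2 ⊢
      rw [Nat.pred_succ] at h2
      rw [pow_succ]
      omega
  · exact h1
  · have h4 : (2 : ℝ) ^ Nat.clog 2 nP ≤ (nP : ℝ) ^ 2 := by
      have : 2 ^ Nat.clog 2 nP ≤ nP ^ 2 := h1.trans (by nlinarith)
      exact_mod_cast this
    have h5 := Real.log_le_log (by positivity) h4
    rw [Real.log_pow, Real.log_pow] at h5
    have l2 : (1 / 2 : ℝ) ≤ Real.log 2 := by have := Real.log_two_gt_d9; linarith
    have : (Nat.clog 2 nP : ℝ) * (1 / 2) ≤ Nat.clog 2 nP * Real.log 2 := by gcongr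
    push_cast at h5
    linarith

theorem runningTime_le_of_peTime_le {ω : Source} {nV nE nP : ℕ} {C : ℝ}
    (h : ∀ pe < nP, ∃ T : ℕ, peTime ω nV nE nP pe ≤ T ∧ (T : ℝ) ≤ C) (hC : 0 ≤ C) :
    (runningTime ω nV nE nP : ℝ≥0∞) ≤ ENNReal.ofReal C := by
  have h1 : runningTime ω nV nE nP ≤ (⌊C⌋₊ : ℕ∞) := by
    refine iSup_le fun pe => ?_
    obtain ⟨T, hT, hTC⟩ := h pe pe.2
    exact hT.trans (by exact_mod_cast Nat.le_floor hTC)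
  calc (runningTime ω nV nE nP : ℝ≥0∞) ≤ ((⌊C⌋₊ : ℕ∞) : ℝ≥0∞) := ENat.toENNReal_le.2 h1
    _ = ENNReal.ofReal (⌊C⌋₊ : ℝ) := by simp
    _ ≤ ENNReal.ofReal C := ENNReal.ofReal_le_ofReal (Nat.floor_le hC)

theorem measure_runningTime_le {c A : ℝ} (hc : 0 < c) (hA : 0 ≤ A) {nV nE nP : ℕ} (hP : 2 ≤ nP)
    (hPA : (nP : ℝ) ≤ A * nV) (hE : nE ≤ nV * (nV - 1)) :
    sourceMeasure {ω | ¬ ((runningTime ω nV nE nP : ℝ≥0∞) ≤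
      ENNReal.ofReal (80000 * (7 + c + A) * (((nV : ℝ) + nE) / nP + Real.log nP)))} ≤
      ENNReal.ofReal ((nP : ℝ) ^ (-c)) := by
  have hP1 : 1 ≤ nP := by omega
  have hP2 : (2 : ℝ) ≤ nP := by exact_mod_cast hP
  have hP0 : (0 : ℝ) < nP := by linarith
  have hn : 1 ≤ nV := by
    by_contra h
    obtain rfl : nV = 0 := by omega
    simp at hPA
    linarith
  obtain ⟨L, hL1, hL2, hL3⟩ := exists_log_two_bound hP
  set Λ : ℝ := ((nV : ℝ) + nE) / nP + Real.log nP with hΛ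
  -- D = (1 + A) + (5 + c): the first part pays for the exponential moment of the sample size, the
  -- second leaves the failure probability P^(-(5 + c)) up to a factor 2P.
  set D : ℝ := 6 + c + A with hD
  have hlog : (1 / 2 : ℝ) ≤ Real.log nP := by
    have h1 := Real.log_two_gt_d9
    have h2 := Real.log_le_log (by norm_num) hP2
    linarith
  have hn0 : (0 : ℝ) ≤ (nV : ℝ) / nP := by positivity
  have hm0 : (0 : ℝ) ≤ (nE : ℝ) / nP := by positivity
  have hΛ' : Λ = (nV : ℝ) / nP + nE / nP + Real.log nP := by rw [hΛ, add_div]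
  have hΛlog : Real.log nP ≤ Λ := by linarith
  have hΛm : (nE : ℝ) / nP ≤ Λ := by linarith
  have hD6 : 6 ≤ D := by linarith
  have hDΛ : 0 ≤ D * Λ := by nlinarith
  -- A potential below e^Q forces κ ≤ 2Q; here Q = DΛ.
  set B : ℕ := ⌈2 * (D * Λ)⌉₊ with hBdef
  have hB1 : 2 * (D * Λ) ≤ B := Nat.le_ceil _
  have hB2 : (B : ℝ) ≤ 2 * (D * Λ) + 1 := (Nat.ceil_lt_add_one (by positivity)).le
  set X : ℝ := Real.exp (-(5 + c) * Real.log nP) with hX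
  let E₁ : ℕ → Set Source := fun pe =>
    {ω | ENNReal.ofReal (Real.exp (D * Λ)) ≤ potential nV nP pe L 0 nP 1 nE ω}
  let E₂ : ℕ → Set Source := fun sd => {ω | skipCount ω sd 0 (30 * B) < B}
  have hE₁ : ∀ pe ∈ Finset.range nP, sourceMeasure (E₁ pe) ≤ ENNReal.ofReal (2 * nP * X) := by
    intro pe hpe
    refine (measure_potential_gt_le hP1 hn hA hPA hE (Finset.mem_range.1 hpe) hL1).trans
      (ENNReal.ofReal_le_ofReal ?_)
    have e1 : (2 : ℝ) ^ L ≤ 2 * nP := by exact_mod_cast hL2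
    refine mul_le_mul e1 (Real.exp_le_exp.2 ?_) (Real.exp_pos _).le (by positivity)
    have e2 : (1 + A) * ((nE : ℝ) / nP) ≤ (1 + A) * Λ := by gcongr
    have e3 : (5 + c) * Real.log nP ≤ (5 + c) * Λ := by gcongr
    have e4 : D * Λ = (1 + A) * Λ + (5 + c) * Λ := by rw [hD]; ring
    linarith
  have hE₂ : ∀ sd ∈ Finset.range (2 * 2 ^ L), sourceMeasure (E₂ sd) ≤ ENNReal.ofReal X := by
    intro sd _
    refine (measure_skipCount_lt_le sd B).trans (ENNReal.ofReal_le_ofReal (Real.exp_le_exp.2 ?_))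
    have e3 : (5 + c) * Real.log nP ≤ (5 + c) * Λ := by gcongr
    have e4 : (5 + c) * Λ ≤ D * Λ := by
      refine mul_le_mul_of_nonneg_right ?_ (by linarith); linarith
    linarith
  have hgood : {ω | ¬ ((runningTime ω nV nE nP : ℝ≥0∞) ≤
      ENNReal.ofReal (80000 * (7 + c + A) * Λ))} ≤ᵐ[sourceMeasure]
      ((⋃ pe ∈ Finset.range nP, E₁ pe) ∪ ⋃ sd ∈ Finset.range (2 * 2 ^ L), E₂ sd : Set Source) := by
    filter_upwards [ae_exists_accept] with ω hω hbad
    by_contra hmem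
    have hmem' : ω ∉ ((⋃ pe ∈ Finset.range nP, E₁ pe) ∪
      ⋃ sd ∈ Finset.range (2 * 2 ^ L), E₂ sd : Set Source) := hmem
    simp only [Set.mem_union, Set.mem_iUnion, Finset.mem_range, exists_prop, not_or, not_exists,
      not_and] at hmem'
    obtain ⟨g1, g2⟩ := hmem'
    refine hbad (runningTime_le_of_peTime_le (fun pe hpe => ?_) (by positivity))
    obtain ⟨κ, τ, hpot, htime⟩ := peTime_le hω hn hP1 hE hpe hL1
      (B := B) fun sd hsd => not_lt.1 (g2 sd hsd)
    obtain ⟨hκ, hτ⟩ := le_of_pow_mul_rejectBase_pow_le (hpot.trans (not_le.1 (g1 pe hpe)).le)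
    refine ⟨_, htime (by exact_mod_cast hκ.trans hB1), ?_⟩
    have hrows : ((rowOf nV nP (pe + 1) - rowOf nV nP pe : ℕ) : ℝ) ≤ (nV : ℝ) / nP + 1 := by
      rw [div_add_one hP0.ne', le_div_iff₀ hP0]
      exact_mod_cast rowOf_succ_sub_mul_le hP1
    -- The main terms are 300 · 15 and 2 · 33900 times DΛ. The additive constants are absorbed
    -- because Λ ≥ log P ≥ 1/2.
    have e : 80000 * (7 + c + A) * Λ = 80000 * (D * Λ) + 80000 * Λ := by rw [hD]; ring
    rw [e]
    push_cast
    linarith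
  refine (measure_mono_ae hgood).trans ((measure_union_le _ _).trans ?_)
  have b1 := (measure_biUnion_finset_le (μ := sourceMeasure) (Finset.range nP) E₁).trans
    (Finset.sum_le_card_nsmul _ _ _ hE₁)
  have b2 := (measure_biUnion_finset_le (μ := sourceMeasure) (Finset.range (2 * 2 ^ L)) E₂).trans
    (Finset.sum_le_card_nsmul _ _ _ hE₂)
  refine (add_le_add b1 b2).trans ?_
  rw [Finset.card_range, Finset.card_range, nsmul_eq_mul, nsmul_eq_mul, ← ENNReal.ofReal_natCast,
    ← ENNReal.ofReal_natCast, ← ENNReal.ofReal_mul (by positivity),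
    ← ENNReal.ofReal_mul (by positivity), ← ENNReal.ofReal_add (by positivity) (by positivity)]
  refine ENNReal.ofReal_le_ofReal ?_
  have hXeq : X * (nP : ℝ) ^ 5 = (nP : ℝ) ^ (-c) := by
    rw [hX, Real.rpow_def_of_pos hP0, ← Real.exp_log (pow_pos hP0 5), ← Real.exp_add, Real.log_pow]
    congr 1
    push_cast
    ring
  rw [← hXeq]
  have hX0 : 0 < X := Real.exp_pos _
  have e1 : ((2 * 2 ^ L : ℕ) : ℝ) ≤ 4 * nP := by
    have : 2 * 2 ^ L ≤ 4 * nP := by omega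
    exact_mod_cast this
  -- P events of probability at most 2P X and at most 4P events of probability at most X; the
  -- surplus exponent 5 absorbs these factors when P ≥ 2.
  have e2 : (2 * nP ^ 2 + 4 * nP : ℝ) ≤ nP ^ 5 := by
    have h3 : (8 : ℝ) ≤ nP ^ 3 := by
      calc (8 : ℝ) = 2 ^ 3 := by norm_num
        _ ≤ nP ^ 3 := by gcongr
    nlinarith [mul_le_mul_of_nonneg_left h3 (sq_nonneg (nP : ℝ))]
  calc (nP : ℝ) * (2 * nP * X) + ((2 * 2 ^ L : ℕ) : ℝ) * X
      ≤ nP * (2 * nP * X) + 4 * nP * X := by gcongr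
    _ = X * (2 * nP ^ 2 + 4 * nP) := by ring
    _ ≤ X * nP ^ 5 := by gcongr

end

end DirectedER

theorem mainTheorem5 (c A : ℝ) (hc : 0 < c) :
    ∃ C : ℝ, 0 < C ∧ ∀ n m P : ℕ, 1 ≤ P → (P : ℝ) ≤ A * n → m ≤ n * (n - 1) →
      DirectedER.sourceMeasure
        {ω | ¬ ((DirectedER.runningTime ω n m P : ℝ≥0∞) ≤
          ENNReal.ofReal (C * (((n : ℝ) + m) / P + Real.log P)))} ≤
        ENNReal.ofReal ((P : ℝ) ^ (-c)) := by
  -- The absolute value keeps the constant positive for every A.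
  refine ⟨80000 * (7 + c + |A|), by positivity, fun n m P hP hPA hm => ?_⟩
  rcases Nat.lt_or_ge P 2 with h | h
  -- Here log P = 0 cannot absorb constants, but the allowed failure probability is 1.
  · obtain rfl : P = 1 := by omega
    simpa using prob_le_one
  · refine DirectedER.measure_runningTime_le hc (abs_nonneg A) h (hPA.trans ?_) hm
    gcongr
    exact le_abs_self A
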